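/- Let $N\ge 1$ and let $\mathcal B_N$ be the free Boolean algebra generated by the symbols $x_1,\dots,x_N$, with operations $\cup,\cap,\bar{\ }$, greatest element $X$ and least element $\emptyset$. Let $\mathcal C_N\subseteq\mathcal B_N$ be the sublattice of the expressions that can be built from $x_1,\dots,x_N$ using only $\cup,\cap,\setminus$, and let $\mathcal M_N$ be the space of functions $\mu\colon\mathcal C_N\to\mathbb R$ with $\mu(f\cup g)=\mu(f)+\mu(g)$ whenever $f\cap g=\emptyset$. For $\emptyset\ne I\subseteq[N]=\{1,\dots,N\}$ put $u_I=\bigcup_{i\in I}x_i$. For every $f\in\mathcal C_N$ there are unique integers $m_{f,I}$ ($\emptyset\neq I\subseteq[N]$) such that $\mu(f)=\sum_{\emptyset\ne I\subseteq[N]}m_{f,I}\,\mu(u_I)$ for all $\mu\in\mathcal M_N$. Every $\mu\in\mathcal M_N$ has a unique extension $\mu\colon\mathcal B_N\to\mathbb R$ with $\mu(f\cup g)=\mu(f)+\mu(g)-\mu(f\cap g)$ for all $f,g\in\mathcal B_N$ and $\mu(X)=0$, called its $0$-weight extension. For a compact convex set $\emptyset\neq K\subset\mathbb R^d$, the quermassintegrals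 $W^d_k(K)$ and the intrinsic volumes $V_k(K)$, $0\le k\le d$, are defined by Steiner's formula $$\mathrm{vol}_d\big(K+B^d(\mathbf 0,r)\big)=\sum_{k=0}^d\binom dk W^d_k(K)\,r^k=\sum_{k=0}^d\kappa_{d-k}V_k(K)\,r^{d-k}\qquad(r\ge 0),$$ where $B^d(\mathbf 0,r)$ is the closed ball of radius $r$ centered at the origin and $\kappa_n$ is the volume of the unit ball of $\mathbb R^n$; put $V_k(K)=0$ for $k>d$. For $\mathbf p=(\mathbf p_1,\dots,\mathbf p_N)\in(\mathbb R^d)^N$ and $\emptyset\ne I\subseteq[N]$ let $K_I(\mathbf p)$ be the convex hull of $\{\mathbf p_i\mid i\in I\}$. For $f\in\mathcal C_N$ set $$W^d_{f,k}(\mathbf p)=\sum_{\emptyset\ne I\subseteq[N]}m_{f,I}W^d_k(K_I(\mathbf p)),\qquad V_{f,k}(\mathbf p)=\sum_{\emptyset\ne I\subseteq[N]}m_{f,I}V_k(K_I(\mathbf p)).$$ As functions of $f\in\mathcal C_N$ these belong to $\mathcal M_N$; for arbitrary $f\in\mathcal B_N$, $W^d_{f,k}(\mathbf p)$ and $V_{f,k}(\mathbf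 p)$ are defined as their $0$-weight extensions. For $f\in\mathcal B_N$, the contradual $f^{\bar *}$ of $f$ is obtained by replacing each variable $x_i$ by its complement $\bar x_i$, and the dual of $f$ is $f^*=\overline{f^{\bar *}}$. **Proposition.** For all $d\ge 0$, $f\in\mathcal B_N$ and $\mathbf p\in(\mathbb R^d)^N$, $$V_{f^*,k}(\mathbf p)=-V_{f^{\bar *},k}(\mathbf p)=(-1)^kV_{f,k}(\mathbf p)\quad\text{for all }k\ge 0,$$ $$W^d_{f^*,k}(\mathbf p)=-W^d_{f^{\bar *},k}(\mathbf p)=(-1)^{d-k}W^d_{f,k}(\mathbf p)\quad\text{for all }0\le k\le d.$$ -/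

import Mathlib

open scoped Pointwise

/-! ### The free Boolean algebra on `N` generators -/

/-- Formal Boolean expressions in the symbols `x_0, …, x_{N-1}`, `X` and `∅`. -/
inductive BoolTerm (N : ℕ) : Type
  | var : Fin N → BoolTerm N
  | full : BoolTerm N
  | empty : BoolTerm N
  | union : BoolTerm N → BoolTerm N → BoolTerm N
  | inter : BoolTerm N → BoolTerm N → BoolTerm N
  | compl : BoolTerm N → BoolTerm N

namespace BoolTerm

/-- Two expressions are equivalent if their equality can be derived from the axioms of a
Boolean algebra (by equational reasoning). -/
inductive Equivalent {N : ℕ} : BoolTerm N → BoolTerm N → Prop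
  | refl (a) : Equivalent a a
  | symm {a b} : Equivalent a b → Equivalent b a
  | trans {a b c} : Equivalent a b → Equivalent b c → Equivalent a c
  | union_congr {a a' b b'} : Equivalent a a' → Equivalent b b' →
      Equivalent (union a b) (union a' b')
  | inter_congr {a a' b b'} : Equivalent a a' → Equivalent b b' →
      Equivalent (inter a b) (inter a' b')
  | compl_congr {a a'} : Equivalent a a' → Equivalent (compl a) (compl a')
  | union_comm (a b) : Equivalent (union a b) (union b a)
  | inter_comm (a b) : Equivalent (inter a b) (inter b a)
  | union_assoc (a b c) : Equivalent (union (union a b) c) (union a (union b c))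
  | inter_assoc (a b c) : Equivalent (inter (inter a b) c) (inter a (inter b c))
  | union_inter_self (a b) : Equivalent (union a (inter a b)) a
  | inter_union_self (a b) : Equivalent (inter a (union a b)) a
  | union_inter_distrib (a b c) :
      Equivalent (union a (inter b c)) (inter (union a b) (union a c))
  | inter_union_distrib (a b c) :
      Equivalent (inter a (union b c)) (union (inter a b) (inter a c))
  | empty_union (a) : Equivalent (union empty a) a
  | full_inter (a) : Equivalent (inter full a) a
  | union_compl (a) : Equivalent (union a (compl a)) full
  | inter_compl (a) : Equivalent (inter a (compl a)) empty

/-- The setoid of equivalence of Boolean expressions. -/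
instance setoid (N : ℕ) : Setoid (BoolTerm N) where
  r := Equivalent
  iseqv := ⟨Equivalent.refl, Equivalent.symm, Equivalent.trans⟩

/-- The value of a formal expression in a Boolean algebra `α`, the variable `x_i` being
replaced by `v i`. -/
def eval {N : ℕ} {α : Type*} [BooleanAlgebra α] (v : Fin N → α) : BoolTerm N → α
  | var i => v i
  | full => ⊤
  | empty => ⊥
  | union a b => eval v a ⊔ eval v b
  | inter a b => eval v a ⊓ eval v b
  | compl a => (eval v a)ᶜ

theorem Equivalent.eval_eq {N : ℕ} {α : Type*} [BooleanAlgebra α] (v : Fin N → α)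
    {a b : BoolTerm N} (h : Equivalent a b) : eval v a = eval v b := by
  induction h with
  | refl a => rfl
  | symm _ ih => exact ih.symm
  | trans _ _ ih1 ih2 => exact ih1.trans ih2
  | union_congr _ _ ih1 ih2 => simp only [eval, ih1, ih2]
  | inter_congr _ _ ih1 ih2 => simp only [eval, ih1, ih2]
  | compl_congr _ ih => simp only [eval, ih]
  | union_comm a b => exact sup_comm _ _
  | inter_comm a b => exact inf_comm _ _
  | union_assoc a b c => exact sup_assoc _ _ _
  | inter_assoc a b c => exact inf_assoc _ _ _
  | union_inter_self a b => exact sup_inf_self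
  | inter_union_self a b => exact inf_sup_self
  | union_inter_distrib a b c => exact sup_inf_left _ _ _
  | inter_union_distrib a b c => exact inf_sup_left _ _ _
  | empty_union a => exact bot_sup_eq _
  | full_inter a => exact top_inf_eq _
  | union_compl a => exact sup_compl_eq_top
  | inter_compl a => exact inf_compl_eq_bot

end BoolTerm

/-- `𝓑_N`: the free Boolean algebra generated by `N` symbols, i.e. equivalence classes of
formal Boolean expressions. -/
def FreeBool (N : ℕ) : Type := Quotient (BoolTerm.setoid N)

namespace FreeBool

open BoolTerm

variable {N : ℕ}

/-- The class of a formal expression. -/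
def mk (t : BoolTerm N) : FreeBool N := Quotient.mk _ t

theorem ind {P : FreeBool N → Prop} (h : ∀ t, P (mk t)) (f : FreeBool N) : P f :=
  Quotient.ind h f

/-- Union of classes of expressions. -/
def union : FreeBool N → FreeBool N → FreeBool N :=
  Quotient.map₂ BoolTerm.union fun _ _ h _ _ h' => Equivalent.union_congr h h'

/-- Intersection of classes of expressions. -/
def inter : FreeBool N → FreeBool N → FreeBool N :=
  Quotient.map₂ BoolTerm.inter fun _ _ h _ _ h' => Equivalent.inter_congr h h'

/-- Complement of classes of expressions. -/
def compl : FreeBool N → FreeBool N :=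
  Quotient.map BoolTerm.compl fun _ _ h => Equivalent.compl_congr h

theorem union_comm (a b : FreeBool N) : union a b = union b a := by
  obtain ⟨a⟩ := a
  obtain ⟨b⟩ := b
  exact Quotient.sound (Equivalent.union_comm a b)

theorem inter_comm (a b : FreeBool N) : inter a b = inter b a := by
  obtain ⟨a⟩ := a
  obtain ⟨b⟩ := b
  exact Quotient.sound (Equivalent.inter_comm a b)

theorem union_assoc (a b c : FreeBool N) : union (union a b) c = union a (union b c) := by
  obtain ⟨a⟩ := a
  obtain ⟨b⟩ := b
  obtain ⟨c⟩ := c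
  exact Quotient.sound (Equivalent.union_assoc a b c)

theorem inter_assoc (a b c : FreeBool N) : inter (inter a b) c = inter a (inter b c) := by
  obtain ⟨a⟩ := a
  obtain ⟨b⟩ := b
  obtain ⟨c⟩ := c
  exact Quotient.sound (Equivalent.inter_assoc a b c)

theorem union_inter_self (a b : FreeBool N) : union a (inter a b) = a := by
  obtain ⟨a⟩ := a
  obtain ⟨b⟩ := b
  exact Quotient.sound (Equivalent.union_inter_self a b)

theorem inter_union_self (a b : FreeBool N) : inter a (union a b) = a := by
  obtain ⟨a⟩ := a
  obtain ⟨b⟩ := b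
  exact Quotient.sound (Equivalent.inter_union_self a b)

theorem union_inter_distrib (a b c : FreeBool N) :
    union a (inter b c) = inter (union a b) (union a c) := by
  obtain ⟨a⟩ := a
  obtain ⟨b⟩ := b
  obtain ⟨c⟩ := c
  exact Quotient.sound (Equivalent.union_inter_distrib a b c)

theorem union_self (a : FreeBool N) : union a a = a := by
  have h := union_inter_self a (union a a)
  rwa [inter_union_self] at h

theorem empty_union (a : FreeBool N) : union (mk BoolTerm.empty) a = a := by
  obtain ⟨a⟩ := a
  exact Quotient.sound (Equivalent.empty_union a)

theorem full_inter (a : FreeBool N) : inter (mk BoolTerm.full) a = a := by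
  obtain ⟨a⟩ := a
  exact Quotient.sound (Equivalent.full_inter a)

theorem union_compl (a : FreeBool N) : union a (compl a) = mk BoolTerm.full := by
  obtain ⟨a⟩ := a
  exact Quotient.sound (Equivalent.union_compl a)

theorem inter_compl (a : FreeBool N) : inter a (compl a) = mk BoolTerm.empty := by
  obtain ⟨a⟩ := a
  exact Quotient.sound (Equivalent.inter_compl a)

/-- The Boolean algebra `𝓑_N`, with `⊔ = ∪`, `⊓ = ∩`, `⊤ = X`, `⊥ = ∅`, and with `f ≤ g`
meaning `f ∪ g = g`. -/
instance : BooleanAlgebra (FreeBool N) where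
  le f g := union f g = g
  le_refl := union_self
  le_trans := by
    intro a b c hab hbc
    rw [← hbc, ← union_assoc, hab]
  le_antisymm := by
    intro a b hab hba
    rw [← hab, union_comm, hba]
  sup := union
  le_sup_left := by
    intro a b
    rw [← union_assoc, union_self]
  le_sup_right := by
    intro a b
    rw [union_comm a b, ← union_assoc, union_self]
  sup_le := by
    intro a b c hac hbc
    rw [union_assoc, hbc, hac]
  inf := inter
  inf_le_left := by
    intro a b
    rw [union_comm, union_inter_self]
  inf_le_right := by
    intro a b
    rw [union_comm, inter_comm, union_inter_self]
  le_inf := by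
    intro a b c hab hac
    rw [union_inter_distrib, hab, hac]
  le_sup_inf := by
    intro a b c
    change union (inter (union a b) (union a c)) (union a (inter b c)) = union a (inter b c)
    rw [union_inter_distrib, union_self]
  top := mk BoolTerm.full
  bot := mk BoolTerm.empty
  compl := compl
  inf_compl_le_bot := by
    intro a
    change union (inter a (compl a)) (mk BoolTerm.empty) = mk BoolTerm.empty
    rw [inter_compl, union_self]
  top_le_sup_compl := by
    intro a
    change union (mk BoolTerm.full) (union a (compl a)) = union a (compl a)
    rw [union_compl, union_self]
  le_top := by
    intro a
    have h := union_inter_self (mk BoolTerm.full) a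
    rwa [full_inter, union_comm] at h
  bot_le := empty_union

/-- The generator `x_i`. -/
def var (i : Fin N) : FreeBool N := mk (BoolTerm.var i)

/-- Evaluation of `f ∈ 𝓑_N` in a Boolean algebra, the variable `x_i` being replaced by
`v i`. -/
def eval {α : Type*} [BooleanAlgebra α] (v : Fin N → α) : FreeBool N → α :=
  Quotient.lift (BoolTerm.eval v) fun _ _ h => Equivalent.eval_eq v h

section EvalLemmas

variable {α : Type*} [BooleanAlgebra α] (v : Fin N → α)

@[simp] theorem eval_var (i : Fin N) : eval v (var i) = v i := rfl

@[simp] theorem eval_top : eval v (⊤ : FreeBool N) = ⊤ := rfl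

@[simp] theorem eval_bot : eval v (⊥ : FreeBool N) = ⊥ := rfl

@[simp] theorem eval_sup (f g : FreeBool N) : eval v (f ⊔ g) = eval v f ⊔ eval v g := by
  obtain ⟨a⟩ := f
  obtain ⟨b⟩ := g
  rfl

@[simp] theorem eval_inf (f g : FreeBool N) : eval v (f ⊓ g) = eval v f ⊓ eval v g := by
  obtain ⟨a⟩ := f
  obtain ⟨b⟩ := g
  rfl

@[simp] theorem eval_compl (f : FreeBool N) : eval v fᶜ = (eval v f)ᶜ := by
  obtain ⟨a⟩ := f
  rfl

@[simp] theorem eval_sdiff (f g : FreeBool N) : eval v (f \ g) = eval v f \ eval v g := by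
  simp [sdiff_eq]

end EvalLemmas

/-- Structural induction on Boolean expressions. -/
theorem induction {P : FreeBool N → Prop} (hvar : ∀ i, P (var i)) (htop : P ⊤) (hbot : P ⊥)
    (hsup : ∀ f g, P f → P g → P (f ⊔ g)) (hinf : ∀ f g, P f → P g → P (f ⊓ g))
    (hcompl : ∀ f, P f → P fᶜ) (f : FreeBool N) : P f := by
  refine ind (fun t => ?_) f
  induction t with
  | var i => exact hvar i
  | full => exact htop
  | empty => exact hbot
  | union a b iha ihb => exact hsup _ _ iha ihb
  | inter a b iha ihb => exact hinf _ _ iha ihb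
  | compl a iha => exact hcompl _ iha

/-- The contradual of `f`: each variable `x_i` is replaced by its complement. -/
def contradual (f : FreeBool N) : FreeBool N := eval (fun i => (var i)ᶜ) f

/-- The dual of `f`: the complement of the contradual of `f`. -/
def dual (f : FreeBool N) : FreeBool N := (contradual f)ᶜ

/-! ### Atoms -/

/-- The truth value of `f` where `x_i` is false exactly for `i ∈ I`. -/
def truth (I : Finset (Fin N)) (f : FreeBool N) : Prop := eval (fun i => i ∉ I) f

section TruthLemmas

variable (I : Finset (Fin N))

@[simp] theorem truth_var (i : Fin N) : truth I (var i) ↔ i ∉ I := Iff.rfl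

@[simp] theorem truth_top : truth I (⊤ : FreeBool N) := trivial

@[simp] theorem truth_bot : ¬ truth I (⊥ : FreeBool N) := fun h => h

@[simp] theorem truth_sup (f g : FreeBool N) : truth I (f ⊔ g) ↔ truth I f ∨ truth I g := by
  simp [truth]

@[simp] theorem truth_inf (f g : FreeBool N) : truth I (f ⊓ g) ↔ truth I f ∧ truth I g := by
  simp [truth]

@[simp] theorem truth_compl (f : FreeBool N) : truth I fᶜ ↔ ¬ truth I f := by
  simp [truth]

@[simp] theorem truth_sdiff (f g : FreeBool N) :
    truth I (f \ g) ↔ truth I f ∧ ¬ truth I g := by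
  simp [sdiff_eq]

theorem truth_finset_sup {ι : Type*} (s : Finset ι) (g : ι → FreeBool N) :
    truth I (s.sup g) ↔ ∃ i ∈ s, truth I (g i) := by
  classical
  induction s using Finset.induction_on with
  | empty => simp
  | insert a s ha ih => simp [ih]

theorem truth_finset_inf {ι : Type*} (s : Finset ι) (g : ι → FreeBool N) :
    truth I (s.inf g) ↔ ∀ i ∈ s, truth I (g i) := by
  classical
  induction s using Finset.induction_on with
  | empty => simp
  | insert a s ha ih => simp [ih]

end TruthLemmas

/-- The atomic element `a_I = (⋂_{j ∉ I} x_j) ∖ (⋃_{i ∈ I} x_i)`. -/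
def atom (I : Finset (Fin N)) : FreeBool N := Iᶜ.inf var \ I.sup var

theorem truth_atom (I J : Finset (Fin N)) : truth J (atom I) ↔ I = J := by
  simp only [atom, truth_sdiff, truth_finset_inf, truth_finset_sup, truth_var,
    Finset.mem_compl, not_exists, not_and, not_not]
  constructor
  · rintro ⟨h1, h2⟩
    ext i
    exact ⟨h2 i, fun hi => by_contra fun h => h1 i h hi⟩
  · rintro rfl
    exact ⟨fun i h => h, fun i h => h⟩

theorem atom_le_of_truth (I : Finset (Fin N)) (f : FreeBool N) :
    (truth I f → atom I ≤ f) ∧ (¬ truth I f → atom I ≤ fᶜ) := by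
  induction f using induction with
  | hvar i =>
    refine ⟨fun h => ?_, fun h => ?_⟩
    · exact sdiff_le.trans (Finset.inf_le (by simpa using h))
    · rw [atom, sdiff_eq]
      exact inf_le_right.trans (compl_le_compl (Finset.le_sup (f := var) (by simpa using h)))
  | htop => simp
  | hbot => simp
  | hsup f g hf hg =>
    refine ⟨fun h => ?_, fun h => ?_⟩
    · rcases (truth_sup I f g).1 h with h | h
      · exact (hf.1 h).trans le_sup_left
      · exact (hg.1 h).trans le_sup_right
    · rw [truth_sup, not_or] at h
      rw [compl_sup]
      exact le_inf (hf.2 h.1) (hg.2 h.2)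
  | hinf f g hf hg =>
    refine ⟨fun h => ?_, fun h => ?_⟩
    · rw [truth_inf] at h
      exact le_inf (hf.1 h.1) (hg.1 h.2)
    · rw [compl_inf]
      rw [truth_inf, not_and_or] at h
      rcases h with h | h
      · exact (hf.2 h).trans le_sup_left
      · exact (hg.2 h).trans le_sup_right
  | hcompl f hf =>
    refine ⟨fun h => hf.2 ((truth_compl I f).1 h), fun h => ?_⟩
    rw [compl_compl]
    exact hf.1 (by simpa using h)

theorem truth_mono {I : Finset (Fin N)} {f g : FreeBool N} (h : f ≤ g) (hf : truth I f) :
    truth I g := by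
  rw [← sup_eq_right.2 h, truth_sup]
  exact Or.inl hf

theorem atom_le_iff (I : Finset (Fin N)) (f : FreeBool N) : atom I ≤ f ↔ truth I f :=
  ⟨fun h => truth_mono h ((truth_atom I I).2 rfl), (atom_le_of_truth I f).1⟩

theorem sup_atom : (Finset.univ : Finset (Finset (Fin N))).sup atom = ⊤ := by
  suffices h : ∀ s : Finset (Fin N), s.powerset.sup (fun I => (s \ I).inf var \ I.sup var) =
      (⊤ : FreeBool N) by
    rw [← h Finset.univ, Finset.powerset_univ]
    rfl
  intro s
  induction s using Finset.induction_on with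
  | empty => simp
  | insert a s ha ih =>
    rw [eq_top_iff, ← ih]
    refine Finset.sup_le fun I hI => ?_
    have hIs := Finset.mem_powerset.1 hI
    have haI : a ∉ I := fun h => ha (hIs h)
    have h1 : (insert a s \ I).inf var \ I.sup var ≤
        (insert a s).powerset.sup
          (fun I => (insert a s \ I).inf var \ I.sup var : Finset (Fin N) → FreeBool N) :=
      Finset.le_sup (f := fun I => ((insert a s \ I).inf var \ I.sup var : FreeBool N))
        (Finset.mem_powerset.2 (hIs.trans (Finset.subset_insert a s)))
    have h2 : (insert a s \ insert a I).inf var \ (insert a I).sup var ≤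
        (insert a s).powerset.sup
          (fun I => (insert a s \ I).inf var \ I.sup var : Finset (Fin N) → FreeBool N) :=
      Finset.le_sup (f := fun I => ((insert a s \ I).inf var \ I.sup var : FreeBool N))
        (Finset.mem_powerset.2 (Finset.insert_subset_insert a hIs))
    have e1 : insert a s \ I = insert a (s \ I) := Finset.insert_sdiff_of_notMem s haI
    have e2 : insert a s \ insert a I = s \ I := by
      ext i
      simp only [Finset.mem_sdiff, Finset.mem_insert]
      constructor
      · rintro ⟨h | h, h'⟩ <;> tauto
      · rintro ⟨h, h'⟩
        refine ⟨Or.inr h, ?_⟩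
        rintro (rfl | h'')
        · exact ha h
        · exact h' h''
    refine le_trans ?_ (sup_le h1 h2)
    rw [e1, e2, Finset.inf_insert, Finset.sup_insert]
    generalize (s \ I).inf (var (N := N)) = A
    generalize I.sup (var (N := N)) = C
    rw [sdiff_eq, sdiff_eq, sdiff_eq, compl_sup]
    generalize Cᶜ = B
    calc A ⊓ B = (A ⊓ B) ⊓ (var a ⊔ (var a)ᶜ) := by rw [sup_compl_eq_top, inf_top_eq]
      _ = (A ⊓ B) ⊓ var a ⊔ (A ⊓ B) ⊓ (var a)ᶜ := inf_sup_left _ _ _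
      _ ≤ _ := by
        refine sup_le_sup (le_of_eq ?_) (le_of_eq ?_)
        · ac_rfl
        · ac_rfl

theorem le_iff_truth {f g : FreeBool N} : f ≤ g ↔ ∀ I, truth I f → truth I g := by
  refine ⟨fun h I => truth_mono h, fun h => ?_⟩
  rw [← inf_top_eq f, ← sup_atom, Finset.sup_inf_distrib_left]
  refine Finset.sup_le fun I _ => ?_
  by_cases hf : truth I f
  · exact inf_le_right.trans ((atom_le_iff I g).2 (h I hf))
  · have := (atom_le_of_truth I f).2 hf
    exact ((disjoint_compl_right.mono_right this : Disjoint f (atom I)).le_bot).trans bot_le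

theorem ext_truth {f g : FreeBool N} (h : ∀ I, truth I f ↔ truth I g) : f = g :=
  le_antisymm (le_iff_truth.2 fun I => (h I).1) (le_iff_truth.2 fun I => (h I).2)

/-! ### Expressions built with `∪`, `∩`, `∖` only -/

/-- `f` can be built from the variables using only the operations `∪`, `∩` and `∖`. -/
inductive IsBounded : FreeBool N → Prop
  | var (i) : IsBounded (var i)
  | sup {f g} : IsBounded f → IsBounded g → IsBounded (f ⊔ g)
  | inf {f g} : IsBounded f → IsBounded g → IsBounded (f ⊓ g)
  | sdiff {f g} : IsBounded f → IsBounded g → IsBounded (f \ g)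

theorem IsBounded.not_truth_univ {f : FreeBool N} (h : IsBounded f) :
    ¬ truth Finset.univ f := by
  induction h with
  | var i => simp
  | sup _ _ h1 h2 => simp [h1, h2]
  | inf _ _ h1 h2 => simp [h1]
  | sdiff _ _ h1 h2 => simp [h1]

theorem isBounded_bot [NeZero N] : IsBounded (⊥ : FreeBool N) := by
  rw [← sdiff_self (a := var (0 : Fin N))]
  exact IsBounded.sdiff (IsBounded.var 0) (IsBounded.var 0)

theorem isBounded_or_compl [NeZero N] (f : FreeBool N) : IsBounded f ∨ IsBounded fᶜ := by
  induction f using induction with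
  | hvar i => exact Or.inl (IsBounded.var i)
  | htop => exact Or.inr (by rw [compl_top]; exact isBounded_bot)
  | hbot => exact Or.inl isBounded_bot
  | hsup f g hf hg =>
    rcases hf with hf | hf <;> rcases hg with hg | hg
    · exact Or.inl (hf.sup hg)
    · right
      have h := hg.sdiff hf
      rwa [sdiff_eq, inf_comm, ← compl_sup] at h
    · right
      have h := hf.sdiff hg
      rwa [sdiff_eq, ← compl_sup] at h
    · right
      rw [compl_sup]
      exact hf.inf hg
  | hinf f g hf hg =>
    rcases hf with hf | hf <;> rcases hg with hg | hg
    · exact Or.inl (hf.inf hg)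
    · left
      have h := hf.sdiff hg
      rwa [sdiff_eq, compl_compl] at h
    · left
      have h := hg.sdiff hf
      rwa [sdiff_eq, compl_compl, inf_comm] at h
    · right
      rw [compl_inf]
      exact hf.sup hg
  | hcompl f hf =>
    rw [compl_compl]
    exact hf.symm

theorem isBounded_iff [NeZero N] (f : FreeBool N) : IsBounded f ↔ ¬ truth Finset.univ f := by
  refine ⟨IsBounded.not_truth_univ, fun h => (isBounded_or_compl f).resolve_right fun h' => ?_⟩
  exact h'.not_truth_univ (by simpa using h)

end FreeBool

/-- The sublattice `𝓒_N` of `𝓑_N` of the expressions that can be built from the variables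
using only `∪`, `∩` and `∖`. -/
def BddExpr (N : ℕ) : Sublattice (FreeBool N) where
  carrier := {f | FreeBool.IsBounded f}
  supClosed' := fun _ hf _ hg => FreeBool.IsBounded.sup hf hg
  infClosed' := fun _ hf _ hg => FreeBool.IsBounded.inf hf hg

namespace BddExpr

open FreeBool

variable {N : ℕ}

/-- The variable `x_i` as an element of `𝓒_N`. -/
def var (i : Fin N) : BddExpr N := ⟨FreeBool.var i, IsBounded.var i⟩

/-- The union `u_I = ⋃_{i ∈ I} x_i`, for a nonempty set `I` of indices. -/
def unionVar (I : {I : Finset (Fin N) // I.Nonempty}) : BddExpr N :=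
  I.1.sup' I.2 var

/-- `𝓜_N`: the linear space of real valued functions `μ` on `𝓒_N` such that
`μ (f ∪ g) = μ f + μ g` if `f ∩ g = ∅`. -/
def additive (N : ℕ) : Submodule ℝ (BddExpr N → ℝ) where
  carrier := {μ | ∀ f g : BddExpr N, (f : FreeBool N) ⊓ (g : FreeBool N) = ⊥ →
    μ (f ⊔ g) = μ f + μ g}
  add_mem' := by
    intro μ ν hμ hν f g h
    simp only [Pi.add_apply, hμ f g h, hν f g h]
    ring
  zero_mem' := by
    intro f g _
    simp
  smul_mem' := by
    intro c μ hμ f g h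
    simp only [Pi.smul_apply, hμ f g h, smul_eq_mul]
    ring

theorem additive_bot [NeZero N] {μ : BddExpr N → ℝ} (hμ : μ ∈ additive N)
    (f : BddExpr N) (hf : (f : FreeBool N) = ⊥) : μ f = 0 := by
  have h := hμ f f (by rw [hf, inf_idem])
  rw [sup_idem] at h
  linarith

/-- `μ (f ∪ g) = μ f + μ (g ∖ f)` and `μ g = μ (f ∩ g) + μ (g ∖ f)`. -/
theorem additive_sup_sdiff {μ : BddExpr N → ℝ} (hμ : μ ∈ additive N)
    (f g d : BddExpr N) (hd : (d : FreeBool N) = (g : FreeBool N) \ f) :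
    μ (f ⊔ g) = μ f + μ d ∧ μ g = μ (f ⊓ g) + μ d := by
  constructor
  · rw [← hμ f d (by rw [hd, inf_sdiff_self_right])]
    congr 1
    apply Subtype.ext
    change (f : FreeBool N) ⊔ g = (f : FreeBool N) ⊔ d
    rw [hd, sup_sdiff_self_right]
  · have hdis : ((f ⊓ g : BddExpr N) : FreeBool N) ⊓ d = ⊥ := by
      change ((f : FreeBool N) ⊓ g) ⊓ d = ⊥
      rw [hd, inf_comm (f : FreeBool N), inf_assoc, inf_sdiff_self_right, inf_bot_eq]
    rw [← hμ _ _ hdis]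
    congr 1
    apply Subtype.ext
    change (g : FreeBool N) = ((f : FreeBool N) ⊓ g) ⊔ d
    rw [hd, inf_comm, sup_inf_sdiff]

theorem additive_modular {μ : BddExpr N → ℝ} (hμ : μ ∈ additive N) (f g : BddExpr N) :
    μ (f ⊔ g) = μ f + μ g - μ (f ⊓ g) := by
  obtain ⟨h1, h2⟩ := additive_sup_sdiff hμ f g ⟨(g : FreeBool N) \ f, g.2.sdiff f.2⟩ rfl
  linarith

/-- `ν : 𝓑_N → ℝ` is a `0`-weight extension of `μ : 𝓒_N → ℝ`. -/
structure IsZeroWeightExtension (μ : BddExpr N → ℝ) (ν : FreeBool N → ℝ) : Prop where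
  extends_eq : ∀ f : BddExpr N, ν f = μ f
  modular : ∀ f g, ν (f ⊔ g) = ν f + ν g - ν (f ⊓ g)
  top_eq : ν ⊤ = 0

open Classical in
theorem existsUnique_zeroWeightExtension [NeZero N] {μ : BddExpr N → ℝ}
    (hμ : μ ∈ additive N) : ∃! ν : FreeBool N → ℝ, IsZeroWeightExtension μ ν := by
  have hc : ∀ f : FreeBool N, ¬ IsBounded f → IsBounded fᶜ :=
    fun f h => (isBounded_or_compl f).resolve_left h
  have hb : IsBounded (⊥ : FreeBool N) := isBounded_bot
  let ν : FreeBool N → ℝ := fun f =>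
    if h : IsBounded f then μ ⟨f, h⟩ else - μ ⟨fᶜ, hc f h⟩
  have ν1 : ∀ (f : FreeBool N) (h : IsBounded f), ν f = μ ⟨f, h⟩ := fun f h => dif_pos h
  have ν2 : ∀ (f : FreeBool N) (h : IsBounded fᶜ), ν f = - μ ⟨fᶜ, h⟩ := by
    intro f h
    refine dif_neg fun h' => ?_
    exact h.not_truth_univ (by simpa using h'.not_truth_univ)
  have mixed : ∀ f g : FreeBool N, IsBounded f → IsBounded gᶜ →
      ν (f ⊔ g) = ν f + ν g - ν (f ⊓ g) := by
    intro f g hf hg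
    have e1 : (f ⊔ g)ᶜ = gᶜ \ f := by rw [compl_sup, sdiff_eq, inf_comm]
    have e2 : f ⊓ g = f \ gᶜ := by rw [sdiff_eq, compl_compl]
    have hb1 : IsBounded (f ⊔ g)ᶜ := e1 ▸ hg.sdiff hf
    have hb2 : IsBounded (f ⊓ g) := e2 ▸ hf.sdiff hg
    rw [ν2 _ hb1, ν1 f hf, ν2 g hg, ν1 _ hb2]
    have h1 := (additive_sup_sdiff hμ ⟨f, hf⟩ ⟨gᶜ, hg⟩ ⟨_, hb1⟩ e1).1
    have h2 := (additive_sup_sdiff hμ ⟨gᶜ, hg⟩ ⟨f, hf⟩ ⟨_, hb2⟩ e2).1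
    rw [sup_comm] at h2
    linarith
  refine ⟨ν, ⟨fun f => ν1 f f.2, fun f g => ?_, ?_⟩, ?_⟩
  · rcases isBounded_or_compl f with hf | hf <;> rcases isBounded_or_compl g with hg | hg
    · rw [ν1 f hf, ν1 g hg, ν1 _ (hf.sup hg), ν1 _ (hf.inf hg)]
      exact additive_modular hμ ⟨f, hf⟩ ⟨g, hg⟩
    · exact mixed f g hf hg
    · have h := mixed g f hg hf
      rw [sup_comm, inf_comm] at h
      linarith
    · have hb1 : IsBounded (f ⊔ g)ᶜ := by
        rw [compl_sup]
        exact hf.inf hg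
      have hb2 : IsBounded (f ⊓ g)ᶜ := by
        rw [compl_inf]
        exact hf.sup hg
      rw [ν2 f hf, ν2 g hg, ν2 _ hb1, ν2 _ hb2]
      have h := additive_modular hμ ⟨fᶜ, hf⟩ ⟨gᶜ, hg⟩
      have h1 : (⟨(f ⊔ g)ᶜ, hb1⟩ : BddExpr N) = ⟨fᶜ, hf⟩ ⊓ ⟨gᶜ, hg⟩ :=
        Subtype.ext compl_sup
      have h2 : (⟨(f ⊓ g)ᶜ, hb2⟩ : BddExpr N) = ⟨fᶜ, hf⟩ ⊔ ⟨gᶜ, hg⟩ :=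
        Subtype.ext compl_inf
      rw [h1, h2]
      linarith
  · have hb' : IsBounded (⊤ : FreeBool N)ᶜ := by
      rw [compl_top]
      exact hb
    rw [ν2 _ hb', additive_bot hμ _ compl_top, neg_zero]
  · intro ρ hρ
    have hρb : ρ ⊥ = 0 := by
      have h := hρ.extends_eq ⟨⊥, hb⟩
      rw [additive_bot hμ _ rfl] at h
      exact h
    funext f
    by_cases h : IsBounded f
    · rw [ν1 f h]
      exact hρ.extends_eq ⟨f, h⟩
    · rw [ν2 f (hc f h), ← hρ.extends_eq ⟨fᶜ, hc f h⟩]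
      have h1 := hρ.modular f fᶜ
      rw [sup_compl_eq_top, inf_compl_eq_bot, hρ.top_eq, hρb] at h1
      change ρ f = - ρ fᶜ
      linarith

/-- The `0`-weight extension of `μ ∈ 𝓜_N` to `𝓑_N`. -/
noncomputable def zeroWeightExtension [NeZero N] (μ : additive N) : FreeBool N → ℝ :=
  (existsUnique_zeroWeightExtension μ.2).choose

theorem isZeroWeightExtension [NeZero N] (μ : additive N) :
    IsZeroWeightExtension μ.1 (zeroWeightExtension μ) :=
  (existsUnique_zeroWeightExtension μ.2).choose_spec.1

/-! ### The inclusion-exclusion coefficients -/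

theorem truth_unionVar (J : Finset (Fin N)) (I : {I : Finset (Fin N) // I.Nonempty}) :
    truth J (unionVar I : FreeBool N) ↔ ¬ I.1 ⊆ J := by
  have h : ∀ (s : Finset (Fin N)) (hs : s.Nonempty),
      ((s.sup' hs var : BddExpr N) : FreeBool N) = s.sup FreeBool.var := by
    intro s hs
    induction hs using Finset.Nonempty.cons_induction with
    | singleton a => simp [var]
    | cons a s ha hs ih =>
      rw [Finset.sup'_cons hs, Finset.sup_cons, ← ih]
      rfl
  rw [unionVar, h, truth_finset_sup]
  simp [Finset.subset_iff]

open Classical in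
theorem modular_eq_sum {ν : FreeBool N → ℝ} (hbot : ν ⊥ = 0)
    (hν : ∀ f g, ν (f ⊔ g) = ν f + ν g - ν (f ⊓ g)) (f : FreeBool N) :
    ν f = ∑ J : Finset (Fin N), if truth J f then ν (atom J) else 0 := by
  have h : ∀ s : Finset (Finset (Fin N)), ν (s.sup atom) = ∑ J ∈ s, ν (atom J) := by
    intro s
    induction s using Finset.induction_on with
    | empty => simpa using hbot
    | insert J s hJ ih =>
      rw [Finset.sup_insert, Finset.sum_insert hJ, hν, ih]
      have : atom J ⊓ s.sup atom = ⊥ := by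
        refine ext_truth fun K => ?_
        simp only [truth_inf, truth_atom, truth_finset_sup, truth_bot, iff_false]
        rintro ⟨rfl, K, hK, rfl⟩
        exact hJ hK
      rw [this, hbot, sub_zero]
  have hf : f = (Finset.univ.filter fun J => truth J f).sup atom := by
    refine ext_truth fun K => ?_
    simp [truth_finset_sup, truth_atom]
  rw [← Finset.sum_filter, ← h, ← hf]

theorem sum_between (J K : Finset (Fin N)) :
    (∑ I : Finset (Fin N), if J ⊆ I ∧ I ⊆ K then (-1 : ℝ) ^ (I \ J).card else 0) =
      if J = K then 1 else 0 := by
  by_cases hJK : J ⊆ K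
  · have h : (∑ I : Finset (Fin N), if J ⊆ I ∧ I ⊆ K then (-1 : ℝ) ^ (I \ J).card else 0) =
        ∑ L ∈ (K \ J).powerset, (-1 : ℝ) ^ L.card := by
      rw [← Finset.sum_filter]
      refine Finset.sum_nbij' (fun I => I \ J) (fun L => J ∪ L) ?_ ?_ ?_ ?_ ?_
      · intro I hI
        simp only [Finset.mem_filter, Finset.mem_univ, true_and] at hI
        exact Finset.mem_powerset.2 (Finset.sdiff_subset_sdiff hI.2 le_rfl)
      · intro L hL
        simp only [Finset.mem_filter, Finset.mem_univ, true_and]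
        have := Finset.mem_powerset.1 hL
        exact ⟨Finset.subset_union_left,
          Finset.union_subset hJK (this.trans Finset.sdiff_subset)⟩
      · intro I hI
        simp only [Finset.mem_filter, Finset.mem_univ, true_and] at hI
        exact Finset.union_sdiff_of_subset hI.1
      · intro L hL
        have := Finset.mem_powerset.1 hL
        exact Finset.union_sdiff_cancel_left
          (Finset.disjoint_of_subset_right this Finset.disjoint_sdiff)
      · intro I hI
        rfl
    rw [h]
    have h2 := congrArg (Int.cast : ℤ → ℝ)
      (Finset.sum_powerset_neg_one_pow_card (x := K \ J))
    push_cast at h2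
    rw [h2]
    have h3 : K \ J = ∅ ↔ J = K := by
      rw [Finset.sdiff_eq_empty_iff_subset]
      exact ⟨fun h => hJK.antisymm h, fun h => h.symm.subset⟩
    simp [h3]
  · rw [if_neg (fun h => hJK h.subset)]
    exact Finset.sum_eq_zero fun I _ => if_neg fun h => hJK (h.1.trans h.2)

open Classical in
theorem unionVar_independent (δ : {I : Finset (Fin N) // I.Nonempty} → ℤ)
    (h : ∀ μ ∈ additive N, ∑ I, (δ I : ℝ) * μ (unionVar I) = 0) : δ = 0 := by
  have h1 : ∀ J : Finset (Fin N), ∑ I, (if ¬ I.1 ⊆ J then δ I else 0) = 0 := by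
    intro J
    have hμ : (fun f : BddExpr N => if truth J (f : FreeBool N) then (1 : ℝ) else 0) ∈
        additive N := by
      intro f g hfg
      have h2 : ¬ (truth J (f : FreeBool N) ∧ truth J (g : FreeBool N)) := by
        rw [← truth_inf, hfg]
        exact truth_bot J
      have h3 : truth J ((f ⊔ g : BddExpr N) : FreeBool N) ↔
          truth J (f : FreeBool N) ∨ truth J (g : FreeBool N) := truth_sup J _ _
      by_cases hf : truth J (f : FreeBool N) <;> by_cases hg : truth J (g : FreeBool N) <;>
        simp_all
    have h2 := h _ hμ
    simp only [truth_unionVar, mul_ite, mul_one, mul_zero] at h2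
    exact_mod_cast h2
  have h2 : ∑ I, δ I = 0 := by
    rw [← h1 ∅]
    refine Finset.sum_congr rfl fun I _ => ?_
    rw [if_pos]
    intro h
    exact I.2.ne_empty (Finset.subset_empty.1 h)
  have h3 : ∀ J : Finset (Fin N), ∑ I, (if I.1 ⊆ J then δ I else 0) = 0 := by
    intro J
    have h4 : ∑ I, ((if I.1 ⊆ J then δ I else 0) + (if ¬ I.1 ⊆ J then δ I else 0)) = 0 := by
      refine Eq.trans (Finset.sum_congr rfl fun I _ => ?_) h2
      by_cases h : I.1 ⊆ J <;> simp [h]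
    rwa [Finset.sum_add_distrib, h1 J, add_zero] at h4
  have h4 : ∀ J : Finset (Fin N), ∀ hJ : J.Nonempty, δ ⟨J, hJ⟩ = 0 := by
    intro J
    induction J using Finset.strongInduction with
    | H J ih =>
      intro hJ
      have h5 := h3 J
      rwa [Finset.sum_eq_single ⟨J, hJ⟩, if_pos le_rfl] at h5
      · intro I _ hI
        by_cases hIJ : I.1 ⊆ J
        · rw [if_pos hIJ]
          exact ih I.1 (hIJ.ssubset_of_ne fun h => hI (Subtype.ext h)) I.2
        · exact if_neg hIJ
      · simp
  funext I
  exact h4 I.1 I.2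

open Classical in
/-- For `f ∈ 𝓒_N` there is a unique collection of integers `m_{f,I}`, `∅ ≠ I ⊆ [N]`, such that
`μ f = ∑_I m_{f,I} μ (u_I)` for every `μ ∈ 𝓜_N`. -/
theorem existsUnique_unionCoeff [NeZero N] (f : BddExpr N) :
    ∃! m : {I : Finset (Fin N) // I.Nonempty} → ℤ,
      ∀ μ ∈ additive N, μ f = ∑ I, (m I : ℝ) * μ (unionVar I) := by
  let c : Finset (Fin N) → ℤ := fun I =>
    ∑ J : Finset (Fin N), if J ⊆ I ∧ truth J (f : FreeBool N) then - (-1) ^ (I \ J).card else 0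
  have key : ∀ μ ∈ additive N, μ f = ∑ I : {I : Finset (Fin N) // I.Nonempty},
      (c I.1 : ℝ) * μ (unionVar I) := by
    intro μ hμ
    obtain ⟨ν, hν, -⟩ := existsUnique_zeroWeightExtension hμ
    have hb : ν ⊥ = 0 := by
      have h := hν.extends_eq ⟨⊥, isBounded_bot⟩
      rw [additive_bot hμ _ rfl] at h
      exact h
    have hsum := modular_eq_sum hb hν.modular
    set w : Finset (Fin N) → ℝ := fun J => ν (atom J) with hw
    have htot : ∑ J, w J = 0 := by
      have h := hsum ⊤
      rw [hν.top_eq] at h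
      simpa using h.symm
    let U : Finset (Fin N) → ℝ := fun I => - ∑ K, if I ⊆ K then w K else 0
    have hU : ∀ I, μ (unionVar I) = U I.1 := by
      intro I
      rw [← hν.extends_eq, hsum]
      have : ∑ K, ((if truth K (unionVar I : FreeBool N) then w K else 0) +
          if I.1 ⊆ K then w K else 0) = 0 := by
        refine Eq.trans (Finset.sum_congr rfl fun K _ => ?_) htot
        by_cases h : I.1 ⊆ K <;> simp [truth_unionVar, h]
      rw [Finset.sum_add_distrib] at this
      change _ = - _
      linarith
    have hU0 : U ∅ = 0 := by simp [U, htot]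
    have hsplit : ∑ I : {I : Finset (Fin N) // I.Nonempty}, (c I.1 : ℝ) * U I.1 =
        ∑ I : Finset (Fin N), (c I : ℝ) * U I := by
      rw [← Finset.sum_subtype (Finset.univ.filter fun I : Finset (Fin N) => I.Nonempty)
        (by simp) (fun I => (c I : ℝ) * U I)]
      refine Finset.sum_filter_of_ne fun I _ h => ?_
      rw [Finset.nonempty_iff_ne_empty]
      rintro rfl
      exact h (by rw [hU0, mul_zero])
    have hterm : ∀ I, (c I : ℝ) * U I = ∑ J, ∑ K, if truth J (f : FreeBool N) then
        w K * (if J ⊆ I ∧ I ⊆ K then (-1 : ℝ) ^ (I \ J).card else 0) else 0 := by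
      intro I
      simp only [c, U, Int.cast_sum, mul_neg, Finset.sum_mul_sum]
      rw [← Finset.sum_neg_distrib]
      refine Finset.sum_congr rfl fun J _ => ?_
      rw [← Finset.sum_neg_distrib]
      refine Finset.sum_congr rfl fun K _ => ?_
      by_cases h1 : J ⊆ I <;> by_cases h2 : I ⊆ K <;>
        by_cases h3 : truth J (f : FreeBool N) <;> simp [h1, h2, h3, mul_comm]
    rw [← hν.extends_eq, hsum]
    simp_rw [hU]
    rw [hsplit]
    simp_rw [hterm]
    rw [Finset.sum_comm]
    refine Finset.sum_congr rfl fun J _ => ?_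
    rw [Finset.sum_comm]
    by_cases h : truth J (f : FreeBool N)
    · simp only [if_pos h, ← Finset.mul_sum, sum_between]
      simp [hw]
    · simp [h]
  refine ⟨fun I => c I.1, key, fun m hm => ?_⟩
  refine sub_eq_zero.1 (unionVar_independent (m - fun I => c I.1) fun μ hμ => ?_)
  simp only [Pi.sub_apply, Int.cast_sub, sub_mul, Finset.sum_sub_distrib]
  rw [← hm μ hμ, ← key μ hμ, sub_self]

/-- The coefficients `m_{f,I}` of `f ∈ 𝓒_N`. -/
noncomputable def unionCoeff [NeZero N] (f : BddExpr N) :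
    {I : Finset (Fin N) // I.Nonempty} → ℤ :=
  (existsUnique_unionCoeff f).choose

theorem unionCoeff_spec [NeZero N] (f : BddExpr N) {μ : BddExpr N → ℝ}
    (hμ : μ ∈ additive N) : μ f = ∑ I, (unionCoeff f I : ℝ) * μ (unionVar I) :=
  (existsUnique_unionCoeff f).choose_spec.1 μ hμ

theorem unionCoeff_add [NeZero N] (f g : BddExpr N)
    (h : (f : FreeBool N) ⊓ (g : FreeBool N) = ⊥) (I : {I : Finset (Fin N) // I.Nonempty}) :
    unionCoeff (f ⊔ g) I = unionCoeff f I + unionCoeff g I := by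
  refine congrFun ((existsUnique_unionCoeff (f ⊔ g)).unique
    (y₂ := fun I => unionCoeff f I + unionCoeff g I)
    (fun μ hμ => unionCoeff_spec (f ⊔ g) hμ) fun μ hμ => ?_) I
  rw [hμ f g h, unionCoeff_spec f hμ, unionCoeff_spec g hμ, ← Finset.sum_add_distrib]
  refine Finset.sum_congr rfl fun I _ => ?_
  push_cast
  ring

/-- For real numbers `v I`, `∅ ≠ I ⊆ [N]`, the map `f ↦ ∑_I m_{f,I} v I` as an element of
`𝓜_N`. -/
noncomputable def combination [NeZero N] (v : {I : Finset (Fin N) // I.Nonempty} → ℝ) :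
    additive N :=
  ⟨fun f => ∑ I, (unionCoeff f I : ℝ) * v I, fun f g h => by
    simp only [unionCoeff_add f g h, Int.cast_add, add_mul, Finset.sum_add_distrib]⟩

end BddExpr

/-! ### Quermassintegrals and intrinsic volumes -/

/-- `κ_n`, the volume of the unit ball of `ℝⁿ`. -/
noncomputable def kappa (n : ℕ) : ℝ :=
  MeasureTheory.volume.real (Metric.closedBall (0 : EuclideanSpace ℝ (Fin n)) 1)

/-- `P` is the Steiner polynomial of `K ⊆ ℝᵈ`: it gives the volume of the distance `r`
parallel body `K + B(0, r)` for all `r ≥ 0`. -/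
def IsSteinerPolynomial {d : ℕ} (K : Set (EuclideanSpace ℝ (Fin d))) (P : Polynomial ℝ) :
    Prop :=
  ∀ r : ℝ, 0 ≤ r → MeasureTheory.volume.real (K + Metric.closedBall 0 r) = P.eval r

theorem IsSteinerPolynomial.unique {d : ℕ} {K : Set (EuclideanSpace ℝ (Fin d))}
    {P Q : Polynomial ℝ} (hP : IsSteinerPolynomial K P) (hQ : IsSteinerPolynomial K Q) :
    P = Q := by
  refine Polynomial.eq_of_infinite_eval_eq P Q ((Set.Ici_infinite (0 : ℝ)).mono ?_)
  intro r hr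
  exact (hP r hr).symm.trans (hQ r hr)

open Classical in
/-- The Steiner polynomial of `K`. By Steiner's formula it exists for every compact convex set
`K`; the value `0` is used for sets without a Steiner polynomial. -/
noncomputable def steinerPolynomial {d : ℕ} (K : Set (EuclideanSpace ℝ (Fin d))) :
    Polynomial ℝ :=
  if h : ∃ P, IsSteinerPolynomial K P then h.choose else 0

theorem IsSteinerPolynomial.eq {d : ℕ} {K : Set (EuclideanSpace ℝ (Fin d))}
    {P : Polynomial ℝ} (hP : IsSteinerPolynomial K P) : steinerPolynomial K = P := by
  have h : ∃ P, IsSteinerPolynomial K P := ⟨P, hP⟩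
  rw [steinerPolynomial, dif_pos h]
  exact h.choose_spec.unique hP

/-- The quermassintegral `W_k^d(K)`, `0 ≤ k ≤ d`, normalized by
`vol_d (K + B(0, r)) = ∑_{k ≤ d} (d choose k) W_k^d(K) r^k`. -/
noncomputable def quermassintegral {d : ℕ} (k : ℕ) (K : Set (EuclideanSpace ℝ (Fin d))) : ℝ :=
  (steinerPolynomial K).coeff k / (d.choose k : ℝ)

/-- The intrinsic volume `V_k(K)` of `K ⊆ ℝᵈ`, normalized by
`vol_d (K + B(0, r)) = ∑_{k ≤ d} κ_{d-k} V_k(K) r^(d-k)`; it is `0` for `k > d`. -/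
noncomputable def intrinsicVolume {d : ℕ} (k : ℕ) (K : Set (EuclideanSpace ℝ (Fin d))) : ℝ :=
  if k ≤ d then (steinerPolynomial K).coeff (d - k) / kappa (d - k) else 0

/-- `K_I(p)`, the convex hull of the points `p_i`, `i ∈ I`. -/
def hullOf {N d : ℕ} (p : Fin N → EuclideanSpace ℝ (Fin d)) (I : Finset (Fin N)) :
    Set (EuclideanSpace ℝ (Fin d)) :=
  convexHull ℝ (p '' (I : Set (Fin N)))

/-- The Boolean quermassintegral `W_{f,k}^d(p)`: it equals `∑_I m_{f,I} W_k^d(K_I(p))` for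
`f ∈ 𝓒_N`, and is defined by `0`-weight extension for arbitrary `f ∈ 𝓑_N`. -/
noncomputable def boolQuermassintegral {N d : ℕ} [NeZero N] (f : FreeBool N) (k : ℕ)
    (p : Fin N → EuclideanSpace ℝ (Fin d)) : ℝ :=
  BddExpr.zeroWeightExtension
    (BddExpr.combination fun I => quermassintegral k (hullOf p I.1)) f

/-- The Boolean intrinsic volume `V_{f,k}(p)`: it equals `∑_I m_{f,I} V_k(K_I(p))` for
`f ∈ 𝓒_N`, and is defined by `0`-weight extension for arbitrary `f ∈ 𝓑_N`. -/
noncomputable def boolIntrinsicVolume {N d : ℕ} [NeZero N] (f : FreeBool N) (k : ℕ)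
    (p : Fin N → EuclideanSpace ℝ (Fin d)) : ℝ :=
  BddExpr.zeroWeightExtension
    (BddExpr.combination fun I => intrinsicVolume k (hullOf p I.1)) f

/-! Duality exchanges ∪ with ∩ and ∅ with X. Hence, for a 0-weight extension ν and a real s, both f
↦ ν(f*) and f ↦ s ν(f) are modular and vanish at ∅ and X, and such functions are determined by their
values at the unions u_I (`eq_of_eq_on_unionVar`). The dual of u_I is the intersection of the x_i, i
∈ I, so inclusion-exclusion (`dual_unionVar_eq_sum`) reduces the claim for V to ∑_{∅ ≠ J ⊆ I}
(-1)^(|J|+1) V_k(K_J) = (-1)^k V_k(K_I), and the claim for W to the same identity with the sign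
(-1)^(d-k). The contradual costs only a sign, since ν of a complement is -ν. Both identities say
that the alternating sum of the r^k-coefficients of the Steiner polynomials of the K_J is (-1)^(d+k)
times that of K_I (`sum_coeff_steinerPolynomial`).

For volumes (`sum_measureReal_convexHull`) this holds pointwise almost everywhere: x ∈ K_J means
that the vectors p_i - x, i ∈ J, have a nontrivial nonnegative linear relation. The linear algebra
statement `balancedSum_eq_strictSign` is proved relative to a subspace W. When one vector changes
sign, both of its sides obey the same recursion, so its truth is unaffected; once all vectors lie in
an open half-space, both sides are zero.

For the other coefficients, the ball is first replaced by a zonotope. Adding a segment to a convex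
body adds a multiple of the volume of a projection to one dimension less, and the projection of K_J
is again the hull of projected points. Each step lowers d and raises the power of r by one, which
preserves the sign (-1)^(d+k) (`exists_polynomial_add_zonotope`). The ball is a limit of zonotopes
(`exists_zonotope_between`), and polynomials of degree at most d that converge at d+1 points
converge coefficientwise. This proves Steiner's formula and the identity together
(`exists_steinerPolynomial`). -/

set_option linter.unusedSectionVars false

/-! ### Alternating sums over balanced subfamilies of vectors -/

section Balanced

variable {ι E : Type*} [DecidableEq ι] [AddCommGroup E] [Module ℝ E]

/-- Some nonnegative, nonzero combination of the vectors `v i`, `i ∈ J`, lies in `W`. -/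
def WeaklyBalanced (W : Submodule ℝ E) (v : ι → E) (J : Finset ι) : Prop :=
  ∃ c : ι → ℝ, (∀ i ∈ J, 0 ≤ c i) ∧ (∃ i ∈ J, 0 < c i) ∧ ∑ i ∈ J, c i • v i ∈ W

/-- `J` is nonempty, and some combination of the vectors `v i`, `i ∈ J`, with positive
coefficients lies in `W`. -/
def StrictlyBalanced (W : Submodule ℝ E) (v : ι → E) (J : Finset ι) : Prop :=
  ∃ c : ι → ℝ, (∀ i ∈ J, 0 < c i) ∧ J.Nonempty ∧ ∑ i ∈ J, c i • v i ∈ W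

/-- The family `v` with the sign of its `n`-th member changed. -/
def flipAt (v : ι → E) (n : ι) : ι → E := Function.update v n (-v n)

@[simp] theorem flipAt_self (v : ι → E) (n : ι) : flipAt v n n = -v n := by simp [flipAt]

theorem flipAt_of_ne (v : ι → E) {n i : ι} (h : i ≠ n) : flipAt v n i = v i := by
  simp [flipAt, h]

theorem sum_smul_flipAt (v : ι → E) {n : ι} {J : Finset ι} (hn : n ∉ J) (c : ι → ℝ) :
    ∑ i ∈ J, c i • flipAt v n i = ∑ i ∈ J, c i • v i :=
  Finset.sum_congr rfl fun i hi => by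
    rw [flipAt_of_ne v (ne_of_mem_of_not_mem hi hn)]

theorem sum_update_smul (v : ι → E) {n : ι} {J : Finset ι} (hn : n ∉ J) (c : ι → ℝ) (t : ℝ) :
    ∑ i ∈ J, Function.update c n t i • v i = ∑ i ∈ J, c i • v i :=
  Finset.sum_congr rfl fun i hi => by
    rw [Function.update_of_ne (ne_of_mem_of_not_mem hi hn)]

/-! ### Balancedness when one vector is added or changes sign -/

variable {W : Submodule ℝ E} {v : ι → E} {n : ι} {J : Finset ι}

/-- As v n ∉ W, the vector v n cannot be the only one with a positive coefficient, so a positive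
coefficient can be required inside J. -/
theorem balanced_insert_iff (hn : n ∉ J) (hW : v n ∉ W) :
    WeaklyBalanced W v (insert n J) ↔ ∃ c : ι → ℝ, (∀ i ∈ J, 0 ≤ c i) ∧ (∃ i ∈ J, 0 < c i) ∧
      ∃ t : ℝ, 0 ≤ t ∧ ∑ i ∈ J, c i • v i + t • v n ∈ W := by
  constructor
  · rintro ⟨c, h0, h1, h2⟩
    rw [Finset.sum_insert hn, add_comm] at h2
    refine ⟨c, fun i hi => h0 i (Finset.mem_insert_of_mem hi), ?_, c n,
      h0 n (Finset.mem_insert_self _ _), h2⟩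
    by_contra! h
    have hz : ∑ i ∈ J, c i • v i = 0 := Finset.sum_eq_zero fun i hi => by
      rw [le_antisymm (h i hi) (h0 i (Finset.mem_insert_of_mem hi)), zero_smul]
    obtain ⟨i, hi, hpos⟩ := h1
    rcases Finset.mem_insert.1 hi with rfl | hi
    · rw [hz, zero_add] at h2
      exact hW ((W.smul_mem_iff hpos.ne').1 h2)
    · exact (h i hi).not_gt hpos
  · rintro ⟨c, h0, ⟨i, hi, hpos⟩, t, ht, h2⟩
    refine ⟨Function.update c n t, fun j hj => ?_, ⟨i, Finset.mem_insert_of_mem hi, ?_⟩, ?_⟩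
    · by_cases hjn : j = n
      · simp [hjn, ht]
      · rw [Function.update_of_ne hjn]
        exact h0 j (Finset.mem_of_mem_insert_of_ne hj hjn)
    · rwa [Function.update_of_ne (ne_of_mem_of_not_mem hi hn)]
    · rw [Finset.sum_insert hn, sum_update_smul v hn, Function.update_self, add_comm]
      exact h2

theorem balanced_insert_flipAt_iff (hn : n ∉ J) (hW : v n ∉ W) :
    WeaklyBalanced W (flipAt v n) (insert n J) ↔ ∃ c : ι → ℝ, (∀ i ∈ J, 0 ≤ c i) ∧
      (∃ i ∈ J, 0 < c i) ∧ ∃ t : ℝ, t ≤ 0 ∧ ∑ i ∈ J, c i • v i + t • v n ∈ W := by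
  rw [balanced_insert_iff hn (by simpa using hW)]
  simp only [sum_smul_flipAt v hn, flipAt_self]
  refine exists_congr fun c => and_congr_right fun _ => and_congr_right fun _ =>
    ⟨fun ⟨t, ht, h⟩ => ⟨-t, by linarith, by simpa using h⟩,
      fun ⟨t, ht, h⟩ => ⟨-t, by linarith, by simpa using h⟩⟩

theorem mem_sup_span_singleton_iff {x y : E} :
    x ∈ W ⊔ Submodule.span ℝ {y} ↔ ∃ t : ℝ, x + t • y ∈ W := by
  rw [Submodule.mem_sup]
  constructor
  · rintro ⟨w, hw, z, hz, rfl⟩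
    obtain ⟨t, rfl⟩ := Submodule.mem_span_singleton.1 hz
    exact ⟨-t, by simpa using hw⟩
  · rintro ⟨t, ht⟩
    exact ⟨_, ht, -(t • y), Submodule.mem_span_singleton.2 ⟨-t, by simp⟩, by simp⟩

/-- Two relations whose coefficients at v n are t ≥ 0 and t' ≤ 0 combine with weights -t' and t to
one in which v n cancels. Conversely, a relation without v n serves for both signs. -/
theorem balanced_flip_and (hn : n ∉ J) (hW : v n ∉ W) :
    WeaklyBalanced W v (insert n J) ∧ WeaklyBalanced W (flipAt v n) (insert n J) ↔ WeaklyBalanced W v J := by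
  rw [balanced_insert_iff hn hW, balanced_insert_flipAt_iff hn hW]
  constructor
  · rintro ⟨⟨c, hc, ⟨i, hi, hci⟩, t, ht, h⟩, c', hc', ⟨i', hi', hci'⟩, t', ht', h'⟩
    rcases ht.eq_or_lt with rfl | ht
    · exact ⟨c, hc, ⟨i, hi, hci⟩, by simpa using h⟩
    · refine ⟨fun j => -t' * c j + t * c' j, fun j hj => ?_, ⟨i', hi', ?_⟩, ?_⟩
      · exact add_nonneg (mul_nonneg (by linarith) (hc j hj)) (mul_nonneg ht.le (hc' j hj))
      · exact add_pos_of_nonneg_of_pos (mul_nonneg (by linarith) (hc i' hi')) (mul_pos ht hci')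
      · have := W.add_mem (W.smul_mem (-t') h) (W.smul_mem t h')
        simp only [add_smul, mul_smul, Finset.sum_add_distrib, ← Finset.smul_sum]
        convert this using 1
        module
  · rintro ⟨c, hc, hpos, h⟩
    exact ⟨⟨c, hc, hpos, 0, le_rfl, by simpa using h⟩, c, hc, hpos, 0, le_rfl, by simpa using h⟩

/-- Modulo v n its coefficient is an arbitrary real number, which is nonnegative or nonpositive. -/
theorem balanced_flip_or (hn : n ∉ J) (hW : v n ∉ W) :
    WeaklyBalanced W v (insert n J) ∨ WeaklyBalanced W (flipAt v n) (insert n J) ↔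
      WeaklyBalanced (W ⊔ Submodule.span ℝ {v n}) v J := by
  rw [balanced_insert_iff hn hW, balanced_insert_flipAt_iff hn hW]
  simp only [WeaklyBalanced, mem_sup_span_singleton_iff]
  constructor
  · rintro (⟨c, hc, hpos, t, -, h⟩ | ⟨c, hc, hpos, t, -, h⟩) <;> exact ⟨c, hc, hpos, t, h⟩
  · rintro ⟨c, hc, hpos, t, h⟩
    rcases le_total 0 t with ht | ht
    · exact Or.inl ⟨c, hc, hpos, t, ht, h⟩
    · exact Or.inr ⟨c, hc, hpos, t, ht, h⟩

theorem strictlyBalanced_insert_iff (hn : n ∉ J) (hW : v n ∉ W) :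
    StrictlyBalanced W v (insert n J) ↔ ∃ c : ι → ℝ, (∀ i ∈ J, 0 < c i) ∧ J.Nonempty ∧
      ∃ t : ℝ, 0 < t ∧ ∑ i ∈ J, c i • v i + t • v n ∈ W := by
  constructor
  · rintro ⟨c, h0, -, h2⟩
    rw [Finset.sum_insert hn, add_comm] at h2
    refine ⟨c, fun i hi => h0 i (Finset.mem_insert_of_mem hi), ?_, c n,
      h0 n (Finset.mem_insert_self _ _), h2⟩
    rw [Finset.nonempty_iff_ne_empty]
    rintro rfl
    rw [Finset.sum_empty, zero_add] at h2
    exact hW ((W.smul_mem_iff (h0 n (Finset.mem_insert_self _ _)).ne').1 h2)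
  · rintro ⟨c, h0, -, t, ht, h2⟩
    refine ⟨Function.update c n t, fun j hj => ?_, Finset.insert_nonempty _ _, ?_⟩
    · by_cases hjn : j = n
      · simp [hjn, ht]
      · rw [Function.update_of_ne hjn]
        exact h0 j (Finset.mem_of_mem_insert_of_ne hj hjn)
    · rw [Finset.sum_insert hn, sum_update_smul v hn, Function.update_self, add_comm]
      exact h2

theorem strictlyBalanced_insert_flipAt_iff (hn : n ∉ J) (hW : v n ∉ W) :
    StrictlyBalanced W (flipAt v n) (insert n J) ↔ ∃ c : ι → ℝ, (∀ i ∈ J, 0 < c i) ∧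
      J.Nonempty ∧ ∃ t : ℝ, t < 0 ∧ ∑ i ∈ J, c i • v i + t • v n ∈ W := by
  rw [strictlyBalanced_insert_iff hn (by simpa using hW)]
  simp only [sum_smul_flipAt v hn, flipAt_self]
  refine exists_congr fun c => and_congr_right fun _ => and_congr_right fun _ =>
    ⟨fun ⟨t, ht, h⟩ => ⟨-t, by linarith, by simpa using h⟩,
      fun ⟨t, ht, h⟩ => ⟨-t, by linarith, by simpa using h⟩⟩

/-- The cancellation of `balanced_flip_and`. For strict balancedness the converse needs v n to
depend on W and the other vectors; see `StrictlyBalanced.insert_of_mem_span`. -/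
theorem StrictlyBalanced.of_flip (hn : n ∉ J) (hW : v n ∉ W)
    (h1 : StrictlyBalanced W v (insert n J))
    (h2 : StrictlyBalanced W (flipAt v n) (insert n J)) : StrictlyBalanced W v J := by
  rw [strictlyBalanced_insert_iff hn hW] at h1
  rw [strictlyBalanced_insert_flipAt_iff hn hW] at h2
  obtain ⟨c, hc, hJ, t, ht, h⟩ := h1
  obtain ⟨c', hc', -, t', ht', h'⟩ := h2
  refine ⟨fun j => -t' * c j + t * c' j, fun j hj => ?_, hJ, ?_⟩
  · exact add_pos (mul_pos (by linarith) (hc j hj)) (mul_pos ht (hc' j hj))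
  · have := W.add_mem (W.smul_mem (-t') h) (W.smul_mem t h')
    simp only [add_smul, mul_smul, Finset.sum_add_distrib, ← Finset.smul_sum]
    convert this using 1
    module

theorem StrictlyBalanced.exists_perturbation {c d : ι → ℝ} (hc : ∀ i ∈ J, 0 < c i) :
    ∃ ε : ℝ, 0 < ε ∧ ∀ i ∈ J, 0 < c i + ε * d i ∧ 0 < c i - ε * d i := by
  induction J using Finset.induction_on with
  | empty => exact ⟨1, one_pos, by simp⟩
  | insert a s ha ih =>
    obtain ⟨ε, hε, h⟩ := ih fun i hi => hc i (Finset.mem_insert_of_mem hi)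
    have hca := hc a (Finset.mem_insert_self _ _)
    have hpos : 0 < |d a| + 1 := by positivity
    -- The summand 1 avoids division by zero and makes the new bound times |d a| strictly smaller
    -- than c a.
    refine ⟨min ε (c a / (|d a| + 1)), lt_min hε (by positivity), fun i hi => ?_⟩
    have hδ : 0 < min ε (c a / (|d a| + 1)) := lt_min hε (by positivity)
    rcases Finset.mem_insert.1 hi with rfl | hi
    · have h1 : min ε (c i / (|d i| + 1)) * (|d i| + 1) ≤ c i :=
        (mul_le_mul_of_nonneg_right (min_le_right _ _) hpos.le).trans
          (div_mul_cancel₀ _ hpos.ne').le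
      constructor <;> nlinarith [neg_abs_le (d i), le_abs_self (d i)]
    · have h1 := h i hi
      have h2 : min ε (c a / (|d a| + 1)) ≤ ε := min_le_left _ _
      have hci := hc i (Finset.mem_insert_of_mem hi)
      rcases le_total 0 (d i) with hd | hd
      · constructor <;> nlinarith
      · constructor <;> nlinarith

/-- Modulo W, a small multiple of v n of either sign is a small combination of the v i, i ∈ J, which
the strictly positive coefficients of a given relation absorb. -/
theorem StrictlyBalanced.insert_of_mem_span (hn : n ∉ J) (hW : v n ∉ W)
    (hv : v n ∈ W ⊔ Submodule.span ℝ (v '' J)) (h : StrictlyBalanced W v J) :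
    StrictlyBalanced W v (insert n J) ∧ StrictlyBalanced W (flipAt v n) (insert n J) := by
  rw [strictlyBalanced_insert_iff hn hW, strictlyBalanced_insert_flipAt_iff hn hW]
  obtain ⟨c, hc, hJ, h⟩ := h
  obtain ⟨w, hw, x, hx, hwx⟩ := Submodule.mem_sup.1 hv
  obtain ⟨d, rfl⟩ : ∃ d : ι → ℝ, ∑ i ∈ J, d i • v i = x := by
    obtain ⟨d, rfl⟩ := (Submodule.mem_span_image_finset_iff_exists_fun' ℝ).1 hx
    exact ⟨d, rfl⟩
  obtain ⟨ε, hε, hcd⟩ := StrictlyBalanced.exists_perturbation (d := d) hc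
  refine ⟨⟨fun i => c i - ε * d i, fun i hi => (hcd i hi).2, hJ, ε, hε, ?_⟩,
    ⟨fun i => c i + ε * d i, fun i hi => (hcd i hi).1, hJ, -ε, by linarith, ?_⟩⟩
  · have := W.add_mem h (W.smul_mem ε hw)
    simp only [sub_smul, mul_smul, Finset.sum_sub_distrib, ← Finset.smul_sum]
    convert this using 1
    rw [← hwx]
    module
  · have := W.add_mem h (W.smul_mem (-ε) hw)
    simp only [add_smul, mul_smul, Finset.sum_add_distrib, ← Finset.smul_sum]
    convert this using 1
    rw [← hwx]
    module

/-- The three cases are the signs of the coefficient of v n. -/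
theorem strictlyBalanced_sup_iff (hn : n ∉ J) (hW : v n ∉ W) :
    StrictlyBalanced (W ⊔ Submodule.span ℝ {v n}) v J ↔ StrictlyBalanced W v J ∨
      StrictlyBalanced W v (insert n J) ∨ StrictlyBalanced W (flipAt v n) (insert n J) := by
  rw [strictlyBalanced_insert_iff hn hW, strictlyBalanced_insert_flipAt_iff hn hW]
  simp only [StrictlyBalanced, mem_sup_span_singleton_iff]
  constructor
  · rintro ⟨c, hc, hJ, t, h⟩
    rcases lt_trichotomy 0 t with ht | rfl | ht
    · exact Or.inr (Or.inl ⟨c, hc, hJ, t, ht, h⟩)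
    · exact Or.inl ⟨c, hc, hJ, by simpa using h⟩
    · exact Or.inr (Or.inr ⟨c, hc, hJ, t, ht, h⟩)
  · rintro (⟨c, hc, hJ, h⟩ | ⟨c, hc, hJ, t, -, h⟩ | ⟨c, hc, hJ, t, -, h⟩)
    · exact ⟨c, hc, hJ, 0, by simpa using h⟩
    · exact ⟨c, hc, hJ, t, h⟩
    · exact ⟨c, hc, hJ, t, h⟩

theorem mem_span_of_strictlyBalanced_insert (hn : n ∉ J)
    (h : StrictlyBalanced W v (insert n J)) : v n ∈ W ⊔ Submodule.span ℝ (v '' J) := by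
  obtain ⟨c, hc, -, h⟩ := h
  rw [Finset.sum_insert hn] at h
  have h1 := Submodule.add_mem_sup h (Submodule.neg_mem _ (Submodule.sum_mem _ fun i hi =>
    Submodule.smul_mem _ (c i) (Submodule.subset_span (Set.mem_image_of_mem v hi)) :
    ∑ i ∈ J, c i • v i ∈ Submodule.span ℝ (v '' J)))
  rw [add_neg_cancel_right] at h1
  exact (Submodule.smul_mem_iff _ (hc n (Finset.mem_insert_self _ _)).ne').1 h1

theorem flipAt_image (hn : n ∉ J) : flipAt v n '' J = v '' J :=
  Set.image_congr fun _ hi => flipAt_of_ne v (ne_of_mem_of_not_mem hi hn)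

theorem sup_span_image_insert (W : Submodule ℝ E) (v : ι → E) (n : ι) (J : Finset ι) :
    W ⊔ Submodule.span ℝ (v '' (insert n J : Finset ι)) =
      W ⊔ Submodule.span ℝ {v n} ⊔ Submodule.span ℝ (v '' J) := by
  rw [Finset.coe_insert, Set.image_insert_eq, Submodule.span_insert, sup_assoc]

/-! ### The two sides of the identity and their recursion under a sign change -/

open Classical in
/-- The alternating number of balanced subfamilies. -/
noncomputable def balancedSum (W : Submodule ℝ E) (v : ι → E) (I : Finset ι) : ℤ :=
  ∑ J ∈ I.powerset, (-1) ^ (J.card + 1) * if WeaklyBalanced W v J then 1 else 0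

open Classical in
/-- The signed indicator of the strict balancedness of `v i`, `i ∈ I`. -/
noncomputable def strictSign (W : Submodule ℝ E) (v : ι → E) (I : Finset ι) : ℤ :=
  (-1) ^ (Module.finrank ℝ W + Module.finrank ℝ ↥(W ⊔ Submodule.span ℝ (v '' I))) *
    if StrictlyBalanced W v I then 1 else 0

open Classical in
theorem balancedSum_insert (hn : n ∉ J) : balancedSum W v (insert n J) =
    balancedSum W v J - ∑ K ∈ J.powerset, (-1) ^ (K.card + 1) *
      if WeaklyBalanced W v (insert n K) then 1 else 0 := by
  rw [balancedSum, Finset.sum_powerset_insert hn, ← balancedSum, sub_eq_add_neg,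
    ← Finset.sum_neg_distrib]
  congr 1
  refine Finset.sum_congr rfl fun K hK => ?_
  rw [Finset.card_insert_of_notMem fun h => hn (Finset.mem_powerset.1 hK h)]
  ring

theorem balancedSum_flipAt_of_notMem (hn : n ∉ J) :
    balancedSum W (flipAt v n) J = balancedSum W v J := by
  unfold balancedSum
  refine Finset.sum_congr rfl fun K hK => ?_
  have : n ∉ K := fun h => hn (Finset.mem_powerset.1 hK h)
  have h : WeaklyBalanced W (flipAt v n) K ↔ WeaklyBalanced W v K := by
    simp only [WeaklyBalanced, sum_smul_flipAt v this]
  rw [propext h]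

/-- Termwise this is [A] + [B] = [A and B] + [A or B] for the two signs of v n, with
`balanced_flip_and` and `balanced_flip_or` evaluating the right side. -/
theorem balancedSum_add_flipAt (hn : n ∉ J) (hW : v n ∉ W) :
    balancedSum W v (insert n J) + balancedSum W (flipAt v n) (insert n J) =
      balancedSum W v J - balancedSum (W ⊔ Submodule.span ℝ {v n}) v J := by
  classical
  have key : ∀ K ∈ J.powerset,
      ((-1) ^ (K.card + 1) * (if WeaklyBalanced W v (insert n K) then 1 else 0) +
        (-1) ^ (K.card + 1) * (if WeaklyBalanced W (flipAt v n) (insert n K) then 1 else 0) : ℤ) =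
      (-1) ^ (K.card + 1) * (if WeaklyBalanced W v K then 1 else 0) +
        (-1) ^ (K.card + 1) *
          (if WeaklyBalanced (W ⊔ Submodule.span ℝ {v n}) v K then 1 else 0) := by
    intro K hK
    have hnK : n ∉ K := fun h => hn (Finset.mem_powerset.1 hK h)
    rw [← mul_add, ← mul_add]
    congr 1
    have h1 := balanced_flip_and hnK hW
    have h2 := balanced_flip_or hnK hW
    by_cases hA : WeaklyBalanced W v (insert n K) <;>
      by_cases hB : WeaklyBalanced W (flipAt v n) (insert n K) <;> simp_all
  have h := Finset.sum_congr (rfl : J.powerset = J.powerset) key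
  rw [Finset.sum_add_distrib, Finset.sum_add_distrib] at h
  rw [balancedSum_insert hn, balancedSum_insert hn, balancedSum_flipAt_of_notMem hn]
  simp only [balancedSum] at h ⊢
  linarith

variable [FiniteDimensional ℝ E]

theorem finrank_sup_span_singleton {U : Submodule ℝ E} {x : E} (hx : x ∉ U) :
    Module.finrank ℝ ↥(U ⊔ Submodule.span ℝ {x}) = Module.finrank ℝ U + 1 := by
  have h0 : x ≠ 0 := fun h => hx (h ▸ U.zero_mem)
  have h1 : U ⊓ Submodule.span ℝ {x} = ⊥ := by
    rw [eq_bot_iff]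
    rintro y ⟨hy, hy'⟩
    obtain ⟨t, rfl⟩ := Submodule.mem_span_singleton.1 hy'
    by_cases ht : t = 0
    · simp [ht]
    · exact absurd ((U.smul_mem_iff ht).1 hy) hx
  have h2 := Submodule.finrank_sup_add_finrank_inf_eq U (Submodule.span ℝ {x})
  rw [h1, finrank_bot, finrank_span_singleton h0] at h2
  simpa using h2

/-- The same recursion as for `balancedSum`. If v n depends on W and the v i, i ∈ J, then strict
balancedness of J is the conjunction of the two signed cases, and [A] + [B] = [A and B] + [A or B]
applies again; passing from W to its sum with v n reverses the sign. Otherwise no relation involves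
v n, both signed terms vanish and the terms on the right cancel. -/
theorem strictSign_add_flipAt (hn : n ∉ J) (hW : v n ∉ W) :
    strictSign W v (insert n J) + strictSign W (flipAt v n) (insert n J) =
      strictSign W v J - strictSign (W ⊔ Submodule.span ℝ {v n}) v J := by
  classical
  have hspan : W ⊔ Submodule.span ℝ (flipAt v n '' (insert n J : Finset ι)) =
      W ⊔ Submodule.span ℝ (v '' (insert n J : Finset ι)) := by
    have h1 : Submodule.span ℝ {-v n} = Submodule.span ℝ {v n} := by
      rw [← Set.neg_singleton, Submodule.span_neg]
    rw [sup_span_image_insert, sup_span_image_insert, flipAt_image hn, flipAt_self, h1]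
  have h1 := sup_span_image_insert W v n J
  simp only [strictSign]
  rw [hspan, ← h1, finrank_sup_span_singleton hW]
  have hD := strictlyBalanced_sup_iff hn hW
  by_cases hv : v n ∈ W ⊔ Submodule.span ℝ (v '' J)
  · have h2 : W ⊔ Submodule.span ℝ (v '' (insert n J : Finset ι)) =
        W ⊔ Submodule.span ℝ (v '' J) := by
      rw [h1, sup_right_comm, sup_eq_left, Submodule.span_singleton_le_iff_mem]
      exact hv
    rw [h2]
    have hC := StrictlyBalanced.insert_of_mem_span hn hW hv
    have hAB := StrictlyBalanced.of_flip hn hW (v := v)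
    by_cases hA : StrictlyBalanced W v (insert n J) <;>
      by_cases hB : StrictlyBalanced W (flipAt v n) (insert n J) <;>
      by_cases hC' : StrictlyBalanced W v J <;> simp_all <;> ring
  · have h2 : Module.finrank ℝ ↥(W ⊔ Submodule.span ℝ (v '' (insert n J : Finset ι))) =
        Module.finrank ℝ ↥(W ⊔ Submodule.span ℝ (v '' J)) + 1 := by
      rw [h1, sup_right_comm, finrank_sup_span_singleton hv]
    have hA : ¬ StrictlyBalanced W v (insert n J) := fun h =>
      hv (mem_span_of_strictlyBalanced_insert hn h)
    have hB : ¬ StrictlyBalanced W (flipAt v n) (insert n J) := fun h => by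
      have := mem_span_of_strictlyBalanced_insert hn h
      rw [flipAt_image hn, flipAt_self, Submodule.neg_mem_iff] at this
      exact hv this
    rw [h2]
    by_cases hC' : StrictlyBalanced W v J <;> simp_all
    ring

/-- Both sides have the same sum over the two signs of v n: by the common recursion that sum only
involves the family without n, where `ih` applies to every subspace. -/
theorem balancedSum_eq_of_flipAt (hn : n ∈ J) (hW : v n ∉ W)
    (ih : ∀ W : Submodule ℝ E, balancedSum W v (J.erase n) = strictSign W v (J.erase n)) :
    balancedSum W v J = strictSign W v J ↔
      balancedSum W (flipAt v n) J = strictSign W (flipAt v n) J := by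
  have h1 := balancedSum_add_flipAt (J.notMem_erase n) hW
  have h2 := strictSign_add_flipAt (J.notMem_erase n) hW
  rw [ih, ih] at h1
  rw [Finset.insert_erase hn] at h1 h2
  constructor <;> intro h <;> linarith

/-- Every subfamily containing n is balanced through v n alone, so the added terms form a full
alternating sum over the subsets of J, which is nonzero only for J = ∅. That is also the only case
in which adding n can change strict balancedness. -/
theorem balancedSum_insert_of_mem (hn : n ∉ J) (hW : v n ∈ W)
    (ih : balancedSum W v J = strictSign W v J) :
    balancedSum W v (insert n J) = strictSign W v (insert n J) := by
  classical
  have hB : ∀ K : Finset ι, WeaklyBalanced W v (insert n K) := fun K => by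
    refine ⟨fun i => if i = n then 1 else 0, fun _ _ => by positivity,
      ⟨n, Finset.mem_insert_self _ _, by simp⟩, ?_⟩
    simpa using hW
  have hspan : W ⊔ Submodule.span ℝ (v '' (insert n J : Finset ι)) =
      W ⊔ Submodule.span ℝ (v '' J) := by
    rw [sup_span_image_insert, sup_eq_left.2 ((Submodule.span_singleton_le_iff_mem _ _).2 hW)]
  rw [balancedSum_insert hn, ih, strictSign, strictSign, hspan]
  simp only [hB, if_true, mul_one, pow_succ, mul_neg, Finset.sum_neg_distrib, sub_neg_eq_add]
  rw [Finset.sum_powerset_neg_one_pow_card]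
  rcases J.eq_empty_or_nonempty with rfl | hJ
  · have h1 : StrictlyBalanced W v (insert n ∅) :=
      ⟨fun _ => 1, fun _ _ => one_pos, Finset.insert_nonempty _ _, by simpa using hW⟩
    have h2 : ¬ StrictlyBalanced W v ∅ := fun ⟨_, _, h, _⟩ => by simp at h
    rw [if_pos h1, if_neg h2, if_pos rfl]
    rw [Finset.coe_empty, Set.image_empty, Submodule.span_empty, sup_bot_eq, ← two_mul, pow_mul]
    simp
  · have : StrictlyBalanced W v (insert n J) ↔ StrictlyBalanced W v J := by
      constructor
      · rintro ⟨c, hc, -, h⟩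
        rw [Finset.sum_insert hn] at h
        exact ⟨c, fun i hi => hc i (Finset.mem_insert_of_mem hi), hJ,
          (Submodule.add_mem_iff_right _ (W.smul_mem _ hW)).1 h⟩
      · rintro ⟨c, hc, -, h⟩
        refine ⟨Function.update c n 1, fun j hj => ?_, Finset.insert_nonempty _ _, ?_⟩
        · by_cases hjn : j = n
          · simp [hjn]
          · rw [Function.update_of_ne hjn]
            exact hc j (Finset.mem_of_mem_insert_of_ne hj hjn)
        · rw [Finset.sum_insert hn, sum_update_smul v hn]
          exact W.add_mem (W.smul_mem _ hW) h
    rw [if_neg hJ.ne_empty]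
    simp [this]

/-- On a nontrivial nonnegative combination ℓ is positive, whereas it vanishes on W. -/
theorem not_balanced_of_pos (ℓ : E →ₗ[ℝ] ℝ) (hℓ : ∀ w ∈ W, ℓ w = 0)
    (hv : ∀ i ∈ J, 0 < ℓ (v i)) : ¬ WeaklyBalanced W v J := by
  rintro ⟨c, hc, ⟨i, hi, hci⟩, h⟩
  have h1 := hℓ _ h
  simp only [map_sum, map_smul, smul_eq_mul] at h1
  exact (Finset.sum_pos' (fun j hj => mul_nonneg (hc j hj) (hv j hj).le)
    ⟨i, hi, mul_pos hci (hv i hi)⟩).ne' h1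

/-- The alternating number of balanced subfamilies of a finite family of vectors is determined
by whether the whole family is strictly balanced. -/
theorem balancedSum_eq_strictSign (I : Finset ι) :
    ∀ (W : Submodule ℝ E) (v : ι → E), balancedSum W v I = strictSign W v I := by
  classical
  induction hm : I.card using Nat.strong_induction_on generalizing I with
  | _ m ih =>
    subst hm
    intro W v
    by_cases hW : ∃ n ∈ I, v n ∈ W
    · obtain ⟨n, hn, hvn⟩ := hW
      have h := balancedSum_insert_of_mem (I.notMem_erase n) hvn
        (ih _ (Finset.card_erase_lt_of_mem hn) _ rfl W v)
      rwa [Finset.insert_erase hn] at h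
    push Not at hW
    -- As no v i lies in W, some functional vanishing on W is nonzero on all v i. Changing the signs
    -- of the vectors on its negative side, one at a time, brings all of them into an open
    -- half-space.
    obtain ⟨ℓ', hℓ'⟩ := Module.exists_dual_forall_apply_ne_zero (K := ℝ)
      (fun i : I => W.mkQ (v i)) (fun i => by simpa using hW i i.2)
    let ℓ : E →ₗ[ℝ] ℝ := ℓ' ∘ₗ W.mkQ
    have hℓ : ∀ w ∈ W, ℓ w = 0 := fun w hw => by
      simp [ℓ, (Submodule.Quotient.mk_eq_zero W).2 hw]
    have hne : ∀ i ∈ I, ℓ (v i) ≠ 0 := fun i hi => hℓ' ⟨i, hi⟩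
    -- The functional stays fixed while the vectors change sign, so its construction from the
    -- original v is forgotten.
    clear_value ℓ
    clear hℓ'
    induction hk : (I.filter fun i => ℓ (v i) < 0).card generalizing v with
    | zero =>
      have hpos : ∀ i ∈ I, 0 < ℓ (v i) := fun i hi => by
        by_contra h
        have : i ∈ I.filter fun i => ℓ (v i) < 0 :=
          Finset.mem_filter.2 ⟨hi, (not_lt.1 h).lt_of_ne (hne i hi)⟩
        rw [Finset.card_eq_zero.1 hk] at this
        simp at this
      have h1 : ¬ StrictlyBalanced W v I := fun ⟨c, hc, ⟨i, hi⟩, h⟩ =>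
        not_balanced_of_pos ℓ hℓ hpos ⟨c, fun j hj => (hc j hj).le, ⟨i, hi, hc i hi⟩, h⟩
      rw [strictSign, if_neg h1, mul_zero]
      refine Finset.sum_eq_zero fun J hJ => ?_
      rw [if_neg (not_balanced_of_pos ℓ hℓ fun i hi => hpos i (Finset.mem_powerset.1 hJ hi)),
        mul_zero]
    | succ k ihk =>
      obtain ⟨n, hn⟩ : (I.filter fun i => ℓ (v i) < 0).Nonempty := by
        rw [← Finset.card_pos]; omega
      have hnI := (Finset.mem_filter.1 hn).1
      have hneg := (Finset.mem_filter.1 hn).2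
      rw [balancedSum_eq_of_flipAt hnI (hW n hnI)
        fun W => ih _ (Finset.card_erase_lt_of_mem hnI) _ rfl W v]
      have hcases : ∀ i, flipAt v n i = v i ∨ flipAt v n i = -v i := fun i => by
        by_cases h : i = n
        · right; rw [h, flipAt_self]
        · exact Or.inl (flipAt_of_ne v h)
      refine ihk (flipAt v n) (fun i hi => ?_) (fun i hi => ?_) ?_
      · rcases hcases i with h | h <;> rw [h]
        · exact hW i hi
        · simpa using hW i hi
      · rcases hcases i with h | h <;> rw [h]
        · exact hne i hi
        · simpa using hne i hi
      · have : (I.filter fun i => ℓ (flipAt v n i) < 0) =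
            (I.filter fun i => ℓ (v i) < 0).erase n := by
          ext i
          by_cases h : i = n
          · subst h
            simp [hneg.le]
          · simp [h, flipAt_of_ne v h]
        rw [this, Finset.card_erase_of_mem hn, hk]
        rfl

end Balanced

/-! ### Alternating sums of volumes of convex hulls -/

section HullVolume

open MeasureTheory

variable {ι E : Type*}

theorem mem_convexHull_image_finset_iff [AddCommGroup E] [Module ℝ E] {p : ι → E}
    {J : Finset ι} {x : E} : x ∈ convexHull ℝ (p '' (J : Set ι)) ↔
      ∃ w : ι → ℝ, (∀ i ∈ J, 0 ≤ w i) ∧ ∑ i ∈ J, w i = 1 ∧ ∑ i ∈ J, w i • p i = x := by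
  classical
  constructor
  · intro hx
    have hc : Convex ℝ {x : E | ∃ w : ι → ℝ, (∀ i ∈ J, 0 ≤ w i) ∧ ∑ i ∈ J, w i = 1 ∧
        ∑ i ∈ J, w i • p i = x} := by
      rintro _ ⟨w, hw, hw1, rfl⟩ _ ⟨w', hw', hw1', rfl⟩ a b ha hb hab
      refine ⟨fun i => a * w i + b * w' i, fun i hi => ?_, ?_, ?_⟩
      · exact add_nonneg (mul_nonneg ha (hw i hi)) (mul_nonneg hb (hw' i hi))
      · rw [Finset.sum_add_distrib, ← Finset.mul_sum, ← Finset.mul_sum, hw1, hw1', mul_one,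
          mul_one, hab]
      · simp only [add_smul, mul_smul, Finset.sum_add_distrib, ← Finset.smul_sum]
    refine convexHull_min ?_ hc hx
    rintro _ ⟨i, hi, rfl⟩
    refine ⟨fun j => if j = i then 1 else 0, fun j _ => ?_, ?_, ?_⟩
    · beta_reduce
      split_ifs <;> norm_num
    · simpa using hi
    · have : i ∈ J := hi
      simp [this]
  · rintro ⟨w, hw, hw1, rfl⟩
    exact (convex_convexHull ℝ _).sum_mem hw hw1 fun i hi =>
      subset_convexHull ℝ _ (Set.mem_image_of_mem p hi)

/-- A nontrivial nonnegative relation among the p i - x becomes a convex combination equal to x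
after division by its total weight. -/
theorem weaklyBalanced_sub_iff [AddCommGroup E] [Module ℝ E] {p : ι → E} {J : Finset ι}
    {x : E} : WeaklyBalanced ⊥ (fun i => p i - x) J ↔ x ∈ convexHull ℝ (p '' (J : Set ι)) := by
  rw [mem_convexHull_image_finset_iff]
  constructor
  · rintro ⟨c, hc, hpos, h⟩
    have hs : 0 < ∑ i ∈ J, c i := Finset.sum_pos' hc hpos
    rw [Submodule.mem_bot] at h
    simp only [smul_sub, Finset.sum_sub_distrib, ← Finset.sum_smul, sub_eq_zero] at h
    refine ⟨fun i => (∑ i ∈ J, c i)⁻¹ * c i,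
      fun i hi => mul_nonneg (inv_nonneg.2 hs.le) (hc i hi), ?_, ?_⟩
    · rw [← Finset.mul_sum, inv_mul_cancel₀ hs.ne']
    · simp only [mul_smul, ← Finset.smul_sum]
      rw [h, inv_smul_smul₀ hs.ne']
  · rintro ⟨w, hw, hw1, h⟩
    refine ⟨w, hw, ?_, ?_⟩
    · by_contra! hn
      have := Finset.sum_nonpos hn
      linarith
    · rw [Submodule.mem_bot]
      simp only [smul_sub, Finset.sum_sub_distrib, ← Finset.sum_smul, hw1, one_smul, h, sub_self]

variable [NormedAddCommGroup E] [NormedSpace ℝ E]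

/-- Let m be the mean of the points. An interior point x can be pushed away from m to x + ε (x - m)
inside the hull. Adding ε / |I| to each weight representing the pushed point gives a relation among
the p i - x with positive coefficients. -/
theorem strictlyBalanced_of_mem_interior {p : ι → E} {I : Finset ι} {x : E}
    (hx : x ∈ interior (convexHull ℝ (p '' (I : Set ι)))) :
    StrictlyBalanced ⊥ (fun i => p i - x) I := by
  have hI : I.Nonempty := by
    rw [Finset.nonempty_iff_ne_empty]
    rintro rfl
    simp at hx
  set m : E := (I.card : ℝ)⁻¹ • ∑ i ∈ I, p i with hm
  have hcont : Filter.Tendsto (fun ε : ℝ => x + ε • (x - m)) (nhdsWithin 0 (Set.Ioi 0))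
      (nhds x) := by
    have : Continuous fun ε : ℝ => x + ε • (x - m) := by fun_prop
    have h := this.tendsto 0
    rw [zero_smul, add_zero] at h
    exact h.mono_left nhdsWithin_le_nhds
  obtain ⟨ε, hε, hpos⟩ := ((hcont.eventually (mem_interior_iff_mem_nhds.1 hx)).and
    self_mem_nhdsWithin).exists
  have hpos : 0 < ε := hpos
  obtain ⟨w, hw, hw1, h⟩ := mem_convexHull_image_finset_iff.1 hε
  have hcard : (I.card : ℝ) ≠ 0 := by simpa using hI.ne_empty
  have hcard' : (0 : ℝ) < I.card := by exact_mod_cast hI.card_pos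
  refine ⟨fun i => w i + ε * (I.card : ℝ)⁻¹, fun i hi => ?_, hI, ?_⟩
  · have := hw i hi
    positivity
  · rw [Submodule.mem_bot]
    have hterm : ∀ i, (w i + ε * (I.card : ℝ)⁻¹) • (p i - x) =
        w i • p i - w i • x + (ε * (I.card : ℝ)⁻¹) • p i - (ε * (I.card : ℝ)⁻¹) • x :=
      fun i => by module
    simp only [hterm, Finset.sum_sub_distrib, Finset.sum_add_distrib, ← Finset.sum_smul, hw1, h,
      ← Finset.smul_sum, Finset.sum_const, nsmul_eq_mul]
    rw [mul_left_comm, mul_inv_cancel₀ hcard, mul_smul, ← hm]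
    module

theorem isCompact_convexHull_image (p : ι → E) (J : Finset ι) :
    IsCompact (convexHull ℝ (p '' (J : Set ι))) :=
  (J.finite_toSet.image p).isCompact_convexHull (𝕜 := ℝ)

variable [FiniteDimensional ℝ E] [DecidableEq ι] [MeasurableSpace E] [BorelSpace E] (μ : Measure E) [μ.IsAddHaarMeasure]

/-- The alternating sum of the volumes of the convex hulls of the subfamilies of a finite family
of points. -/
theorem sum_measureReal_convexHull (p : ι → E) (I : Finset ι) :
    ∑ J ∈ I.powerset, (-1 : ℝ) ^ (J.card + 1) * μ.real (convexHull ℝ (p '' (J : Set ι))) =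
      (-1) ^ Module.finrank ℝ E * μ.real (convexHull ℝ (p '' (I : Set ι))) := by
  classical
  have hcpt := isCompact_convexHull_image p
  -- If the points do not span the space affinely, all hulls are null sets and both sides vanish.
  by_cases htop : affineSpan ℝ (p '' (I : Set ι)) = ⊤
  swap
  · have h0 : ∀ J ∈ I.powerset, μ (convexHull ℝ (p '' (J : Set ι))) = 0 := fun J hJ =>
      measure_mono_null ((convexHull_mono (Set.image_mono
        (Finset.coe_subset.2 (Finset.mem_powerset.1 hJ)))).trans
        (convexHull_subset_affineSpan _)) (Measure.addHaar_affineSubspace μ _ htop)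
    have hI := h0 I (Finset.mem_powerset_self I)
    rw [measureReal_def, hI, ENNReal.toReal_zero, mul_zero]
    refine Finset.sum_eq_zero fun J hJ => ?_
    rw [measureReal_def, h0 J hJ, ENNReal.toReal_zero, mul_zero]
  have hspan : ∀ x, Submodule.span ℝ ((fun i => p i - x) '' (I : Set ι)) = ⊤ := by
    intro x
    have hdir : vectorSpan ℝ (p '' (I : Set ι)) = ⊤ := by
      rw [← direction_affineSpan, htop, AffineSubspace.direction_top]
    rw [eq_top_iff, ← hdir, vectorSpan, Submodule.span_le]
    rintro _ ⟨_, ⟨i, hi, rfl⟩, _, ⟨j, hj, rfl⟩, rfl⟩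
    have h := Submodule.sub_mem (Submodule.span ℝ ((fun i => p i - x) '' (I : Set ι)))
      (Submodule.subset_span ⟨i, hi, rfl⟩) (Submodule.subset_span ⟨j, hj, rfl⟩)
    simpa using h
  -- Off the frontier of the hull of all points, which is a null set, belonging to that hull is the
  -- same as strict balancedness of the whole family. The sign exponent is the dimension of the span
  -- of the p i - x, which is the full dimension.
  have hpt : ∀ᵐ x ∂μ, ∑ J ∈ I.powerset, (-1 : ℝ) ^ (J.card + 1) *
      (convexHull ℝ (p '' (J : Set ι))).indicator 1 x =
      (-1) ^ Module.finrank ℝ E * (convexHull ℝ (p '' (I : Set ι))).indicator 1 x := by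
    have hfr : ∀ᵐ x ∂μ, x ∉ frontier (convexHull ℝ (p '' (I : Set ι))) :=
      measure_eq_zero_iff_ae_notMem.1 ((convex_convexHull ℝ _).addHaar_frontier μ)
    filter_upwards [hfr] with x hx
    have h := congrArg (Int.cast : ℤ → ℝ)
      (balancedSum_eq_strictSign I (⊥ : Submodule ℝ E) fun i => p i - x)
    have hstrict : StrictlyBalanced ⊥ (fun i => p i - x) I ↔
        x ∈ convexHull ℝ (p '' (I : Set ι)) := by
      constructor
      · rintro ⟨c, hc, ⟨i, hi⟩, h⟩
        exact weaklyBalanced_sub_iff.1 ⟨c, fun j hj => (hc j hj).le, ⟨i, hi, hc i hi⟩, h⟩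
      · intro h
        refine strictlyBalanced_of_mem_interior ?_
        by_contra h'
        exact hx ⟨subset_closure h, h'⟩
    simp only [balancedSum, strictSign, weaklyBalanced_sub_iff, hstrict] at h
    rw [hspan, bot_sup_eq, finrank_top, finrank_bot, zero_add] at h
    push_cast at h
    simpa [Set.indicator_apply] using h
  have hint : ∀ J : Finset ι,
      Integrable ((convexHull ℝ (p '' (J : Set ι))).indicator (1 : E → ℝ)) μ := fun J =>
    (integrable_indicator_iff (hcpt J).measurableSet).2
      (integrableOn_const (hcpt J).measure_lt_top.ne)
  have h := integral_congr_ae hpt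
  rw [integral_finsetSum _ fun J _ => (hint J).const_mul _, integral_const_mul,
    integral_indicator_one (hcpt I).measurableSet] at h
  rw [← h]
  refine Finset.sum_congr rfl fun J _ => ?_
  rw [integral_const_mul, integral_indicator_one (hcpt J).measurableSet]

end HullVolume

/-! ### The volume of the sum of a convex body and a segment -/

section SegmentSum

open MeasureTheory

/-- The segment `[-z, z]`. -/
def symSegment {E : Type*} [AddCommGroup E] [Module ℝ E] (z : E) : Set E :=
  (fun s : ℝ => s • z) '' Set.Icc (-1) 1

theorem image_symSegment {E F : Type*} [AddCommGroup E] [Module ℝ E] [AddCommGroup F]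
    [Module ℝ F] (f : E →ₗ[ℝ] F) (z : E) : f '' symSegment z = symSegment (f z) := by
  simp only [symSegment, Set.image_image, map_smul]

theorem isCompact_symSegment {E : Type*} [NormedAddCommGroup E] [NormedSpace ℝ E] (z : E) :
    IsCompact (symSegment z) :=
  isCompact_Icc.image (by fun_prop)

theorem convex_symSegment {E : Type*} [AddCommGroup E] [Module ℝ E] (z : E) :
    Convex ℝ (symSegment z) :=
  (convex_Icc (-1 : ℝ) 1).linear_image (LinearMap.toSpanSingleton ℝ E z)

theorem symSegment_zero {E : Type*} [AddCommGroup E] [Module ℝ E] :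
    symSegment (0 : E) = 0 := by
  ext x
  simp only [symSegment, smul_zero, Set.mem_image, exists_and_right, Set.mem_zero]
  exact ⟨fun h => h.2.symm, fun h => ⟨⟨0, by norm_num⟩, h.symm⟩⟩

theorem volume_slice_add_symSegment {T : Set ℝ} (hT : IsCompact T) (hc : Convex ℝ T)
    (hne : T.Nonempty) {r : ℝ} (hr : 0 ≤ r) :
    volume (T + Set.Icc (-r) r) = volume T + ENNReal.ofReal (2 * r) := by
  have hconn : IsConnected T := ⟨hne, hc.isPreconnected⟩
  have hle : sInf T ≤ sSup T :=
    (csInf_le hT.bddBelow hne.some_mem).trans (le_csSup hT.bddAbove hne.some_mem)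
  rw [eq_Icc_of_connected_compact hconn hT, Set.Icc_add_Icc hle (by linarith), Real.volume_Icc,
    Real.volume_Icc, ← ENNReal.ofReal_add (by linarith) (by linarith)]
  congr 1
  ring

variable {F : Type*} [NormedAddCommGroup F] [NormedSpace ℝ F] [FiniteDimensional ℝ F]
  [MeasurableSpace F] [BorelSpace F] (ν : Measure F) [ν.IsAddHaarMeasure]

/-- Fubini: each nonempty fibre of K in the direction of the segment is a compact interval, which
grows by r at both ends, and the fibre over y is nonempty exactly when y is in the projection. -/
theorem prod_add_symSegment {K : Set (ℝ × F)} (hK : IsCompact K) (hc : Convex ℝ K) {r : ℝ}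
    (hr : 0 ≤ r) : (volume.prod ν).real (K + symSegment (r • ((1, 0) : ℝ × F))) =
      (volume.prod ν).real K + 2 * r * ν.real (Prod.snd '' K) := by
  have hKs : IsCompact (K + symSegment (r • ((1, 0) : ℝ × F))) :=
    hK.add (isCompact_symSegment _)
  have hKp : IsCompact (Prod.snd '' K) := hK.image continuous_snd
  have hmem : ∀ y : F, (fun t : ℝ => (t, y)) ⁻¹' (K + symSegment (r • ((1, 0) : ℝ × F))) =
      (fun t : ℝ => (t, y)) ⁻¹' K + Set.Icc (-r) r := by
    intro y
    ext t
    simp only [Set.mem_preimage, Set.mem_add, symSegment, Set.mem_image]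
    constructor
    · rintro ⟨⟨t', y'⟩, hk, _, ⟨s, hs, rfl⟩, h⟩
      simp only [Prod.smul_mk, smul_eq_mul, mul_one, smul_zero, Prod.mk_add_mk, add_zero,
        Prod.mk.injEq] at h
      obtain ⟨h, rfl⟩ := h
      refine ⟨t', hk, s * r, ⟨?_, ?_⟩, h⟩ <;> nlinarith [hs.1, hs.2]
    · rintro ⟨t', hk, s, hs, rfl⟩
      rcases hr.eq_or_lt with rfl | hr
      · have : s = 0 := by linarith [hs.1, hs.2]
        exact ⟨(t', y), hk, 0, ⟨0, by norm_num, by simp⟩, by simp [this]⟩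
      · refine ⟨(t', y), hk, _, ⟨s / r, ⟨?_, ?_⟩, rfl⟩, ?_⟩
        · rw [le_div_iff₀ hr]; linarith [hs.1]
        · rw [div_le_iff₀ hr]; linarith [hs.2]
        · simp [div_mul_cancel₀ s hr.ne']
  have hslice : ∀ y : F, volume ((fun t : ℝ => (t, y)) ⁻¹'
      (K + symSegment (r • ((1, 0) : ℝ × F)))) = volume ((fun t : ℝ => (t, y)) ⁻¹' K) +
        (Prod.snd '' K).indicator (fun _ => ENNReal.ofReal (2 * r)) y := by
    intro y
    rw [hmem]
    by_cases hy : y ∈ Prod.snd '' K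
    · rw [Set.indicator_of_mem hy]
      refine volume_slice_add_symSegment ?_ ?_ ?_ hr
      · have hemb : Topology.IsClosedEmbedding fun t : ℝ => (t, y) :=
          Isometry.isClosedEmbedding (Isometry.of_dist_eq fun a b => by simp [Prod.dist_eq])
        exact hemb.isCompact_preimage hK
      · intro a ha b hb s t hs ht hst
        have h := hc ha hb hs ht hst
        simpa [← add_smul, hst] using h
      · obtain ⟨⟨t, y'⟩, h, rfl⟩ := hy
        exact ⟨t, h⟩
    · have h : (fun t : ℝ => (t, y)) ⁻¹' K = ∅ := by
        rw [Set.eq_empty_iff_forall_notMem]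
        exact fun t ht => hy ⟨(t, y), ht, rfl⟩
      rw [Set.indicator_of_notMem hy, h, Set.empty_add, measure_empty, add_zero]
  have h : (volume.prod ν) (K + symSegment (r • ((1, 0) : ℝ × F))) =
      (volume.prod ν) K + ENNReal.ofReal (2 * r) * ν (Prod.snd '' K) := by
    rw [Measure.prod_apply_symm hKs.measurableSet, Measure.prod_apply_symm hK.measurableSet]
    simp_rw [hslice]
    rw [lintegral_add_right _ (measurable_const.indicator hKp.measurableSet),
      lintegral_indicator_const hKp.measurableSet]
  rw [measureReal_def, h, ENNReal.toReal_add hK.measure_lt_top.ne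
    (ENNReal.mul_ne_top ENNReal.ofReal_ne_top hKp.measure_lt_top.ne), ENNReal.toReal_mul,
    ENNReal.toReal_ofReal (by linarith)]
  rfl

/-- Adding a segment to a convex body changes the volume by a multiple of the volume of a
projection of the body. -/
theorem exists_projection_add_symSegment {E : Type*} [NormedAddCommGroup E] [NormedSpace ℝ E]
    [FiniteDimensional ℝ E] [MeasurableSpace E] [BorelSpace E] (μ : Measure E)
    [μ.IsAddHaarMeasure] (hEF : Module.finrank ℝ E = Module.finrank ℝ F + 1) {z : E}
    (hz : z ≠ 0) : ∃ (π : E →ₗ[ℝ] F) (c : ℝ), ∀ K : Set E, IsCompact K → Convex ℝ K →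
      ∀ r : ℝ, 0 ≤ r → μ.real (K + symSegment (r • z)) = μ.real K + r * (c * ν.real (π '' K)) := by
  have hfin : Module.finrank ℝ E = Module.finrank ℝ (ℝ × F) := by
    rw [Module.finrank_prod, Module.finrank_self, hEF, add_comm]
  let L₀ : E ≃L[ℝ] ℝ × F := ContinuousLinearEquiv.ofFinrankEq hfin
  -- Coordinates in which z is the unit vector of the first factor.
  obtain ⟨A, hA⟩ := SeparatingDual.exists_continuousLinearEquiv_apply_eq (R := ℝ)
    (x := L₀ z) (y := ((1, 0) : ℝ × F)) (by simpa using hz) (by simp)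
  let L : E ≃L[ℝ] ℝ × F := L₀.trans A
  have hL : L z = (1, 0) := hA
  have hmap : (μ.map L).IsAddHaarMeasure :=
    L.toContinuousAddEquiv.isAddHaarMeasure_map μ
  -- By uniqueness of Haar measure the coordinate change multiplies volumes by a constant k; the
  -- fibre growth 2r then gives the factor 2k.
  have hscale := Measure.isAddLeftInvariant_eq_smul (μ.map L) (volume.prod ν)
  set k := Measure.addHaarScalarFactor (μ.map L) (volume.prod ν)
  have hμ : ∀ S : Set E, μ.real S = k * (volume.prod ν).real (L '' S) := by
    intro S
    have h : (μ.map L) (L '' S) = μ S := by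
      have := L.toHomeomorph.toMeasurableEquiv.map_apply (μ := μ) (L '' S)
      refine this.trans ?_
      congr 1
      exact Set.preimage_image_eq S L.injective
    rw [measureReal_def, ← h, hscale, measureReal_def]
    simp
  refine ⟨LinearMap.snd ℝ ℝ F ∘ₗ L.toLinearEquiv.toLinearMap, k * 2, fun K hK hc r hr => ?_⟩
  have himg : L '' (K + symSegment (r • z)) =
      L '' K + symSegment (r • ((1, 0) : ℝ × F)) := by
    have h1 := image_symSegment L.toLinearEquiv.toLinearMap (r • z)
    have h2 : L.toLinearEquiv.toLinearMap (r • z) = r • ((1, 0) : ℝ × F) := by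
      rw [map_smul, ← hL]
      rfl
    rw [h2] at h1
    rw [Set.image_add, ← h1]
    rfl
  have hsnd : (LinearMap.snd ℝ ℝ F ∘ₗ L.toLinearEquiv.toLinearMap) '' K =
      Prod.snd '' (L '' K) := by
    rw [Set.image_image]
    rfl
  rw [hμ, hμ, himg, hsnd, prod_add_symSegment ν (hK.image L.continuous)
    (hc.linear_image L.toLinearEquiv.toLinearMap) hr]
  ring

end SegmentSum

/-! ### The volume of the sum of a convex body and a zonotope -/

section Zonotope

open MeasureTheory

/-- The sum of the segments `[-z, z]`, where `z` runs over the members of a list. -/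
def zonotope {E : Type*} [AddCommGroup E] [Module ℝ E] : List E → Set E
  | [] => 0
  | z :: l => symSegment z + zonotope l

theorem image_zonotope {E F : Type*} [AddCommGroup E] [Module ℝ E] [AddCommGroup F]
    [Module ℝ F] (f : E →ₗ[ℝ] F) (l : List E) : f '' zonotope l = zonotope (l.map f) := by
  induction l with
  | nil =>
    simp only [zonotope, List.map_nil, Set.image_zero, map_zero]
    rfl
  | cons z l ih => rw [zonotope, Set.image_add, image_symSegment, ih, List.map_cons, zonotope]

theorem zonotope_map_smul {E : Type*} [AddCommGroup E] [Module ℝ E] (r : ℝ) (l : List E) :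
    zonotope (l.map (r • ·)) = r • zonotope l :=
  (image_zonotope (LinearMap.lsmul ℝ E r) l).symm

theorem convex_zonotope {E : Type*} [AddCommGroup E] [Module ℝ E] (l : List E) :
    Convex ℝ (zonotope l) := by
  induction l with
  | nil => exact convex_singleton 0
  | cons z l ih => exact (convex_symSegment z).add ih

theorem isCompact_zonotope {E : Type*} [NormedAddCommGroup E] [NormedSpace ℝ E] (l : List E) :
    IsCompact (zonotope l) := by
  induction l with
  | nil => exact isCompact_singleton
  | cons z l ih => exact (isCompact_symSegment z).add ih

/-- The volume of the sum of a convex body and `r` times a zonotope is a polynomial in `r`; its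
coefficients are homogeneous under passing to alternating sums over convex hulls of
subfamilies of a family of points. -/
theorem exists_polynomial_add_zonotope {N d : ℕ} (l : List (EuclideanSpace ℝ (Fin d))) :
    ∃ P : Set (EuclideanSpace ℝ (Fin d)) → Polynomial ℝ, (∀ K, (P K).natDegree ≤ d) ∧
      (∀ K, IsCompact K → Convex ℝ K → ∀ r : ℝ, 0 ≤ r →
        volume.real (K + r • zonotope l) = (P K).eval r) ∧
      ∀ (p : Fin N → EuclideanSpace ℝ (Fin d)) (I : Finset (Fin N)) (k : ℕ),
        ∑ J ∈ I.powerset, (-1 : ℝ) ^ (J.card + 1) * (P (hullOf p J)).coeff k =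
          (-1) ^ (d + k) * (P (hullOf p I)).coeff k := by
  induction hn : l.length generalizing d l with
  | zero =>
    rw [List.length_eq_zero_iff] at hn
    subst hn
    refine ⟨fun K => Polynomial.C (volume.real K), fun K => by simp, fun K _ _ r _ => ?_,
      fun p I k => ?_⟩
    · simp [zonotope]
    · rcases k with - | k
      · have h := sum_measureReal_convexHull (volume : Measure (EuclideanSpace ℝ (Fin d))) p I
        rw [finrank_euclideanSpace_fin] at h
        simpa [hullOf] using h
      · simp
  | succ n ih =>
    obtain ⟨z, l, rfl⟩ := List.exists_cons_of_length_eq_add_one hn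
    obtain ⟨P, hP, hPv, hPs⟩ := ih l (by simpa using hn)
    by_cases hz : z = 0
    · refine ⟨P, hP, fun K hK hc r hr => ?_, hPs⟩
      rw [zonotope, hz, symSegment_zero, zero_add, hPv K hK hc r hr]
    rcases d with - | d
    -- There is no nonzero generator in dimension zero.
    · exact absurd (Subsingleton.elim z 0) hz
    obtain ⟨π, c, hπ⟩ := exists_projection_add_symSegment
      (volume : Measure (EuclideanSpace ℝ (Fin d)))
      (volume : Measure (EuclideanSpace ℝ (Fin (d + 1)))) (by simp) hz
    obtain ⟨Q, hQ, hQv, hQs⟩ := ih (l.map π) (by simpa using hn)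
    -- P handles the remaining generators, and Q their projections along z; the length of the
    -- segment r • z contributes the factor r.
    refine ⟨fun K => P K + Polynomial.C c * Polynomial.X * Q (π '' K), fun K => ?_,
      fun K hK hc r hr => ?_, fun p I k => ?_⟩
    · refine (Polynomial.natDegree_add_le _ _).trans (max_le (hP K) ?_)
      refine (Polynomial.natDegree_mul_le).trans ?_
      have h1 := hQ (π '' K)
      have h2 := (Polynomial.natDegree_C_mul_le c Polynomial.X).trans Polynomial.natDegree_X_le
      omega
    · have hsum : K + r • zonotope (z :: l) = (K + r • zonotope l) + symSegment (r • z) := by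
        rw [← zonotope_map_smul, ← zonotope_map_smul, List.map_cons, zonotope,
          add_comm (symSegment _), add_assoc]
      have himg : π '' (K + r • zonotope l) = π '' K + r • zonotope (l.map π) := by
        rw [Set.image_add, Set.image_smul_comm _ _ _ fun x => map_smul π r x, image_zonotope]
      rw [hsum, hπ _ (hK.add ((isCompact_zonotope l).smul r)) (hc.add ((convex_zonotope l).smul r))
        r hr, himg, hPv K hK hc r hr,
        hQv _ (hK.image π.continuous_of_finiteDimensional) (hc.linear_image π) r hr]
      simp
      ring
    · have hhull : ∀ J, π '' hullOf p J = hullOf (fun i => π (p i)) J := fun J => by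
        rw [hullOf, LinearMap.image_convexHull, Set.image_image]
        rfl
      simp only [hhull, Polynomial.coeff_add, mul_add, Finset.sum_add_distrib, hPs]
      congr 1
      rcases k with - | k
      · simp
      · simp only [mul_assoc, Polynomial.coeff_C_mul, Polynomial.coeff_X_mul]
        have h := congrArg (c * ·) (hQs (fun i => π (p i)) I k)
        simp only [Finset.mul_sum] at h
        -- Dimension and degree both differ by one from those for Q, so the sign agrees.
        rw [show (-1 : ℝ) ^ (d + 1 + (k + 1)) = (-1) ^ (d + k) by ring, mul_left_comm, ← h]
        exact Finset.sum_congr rfl fun J _ => mul_left_comm _ _ _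

end Zonotope

/-! ### Approximation of the ball by zonotopes -/

section BallApproximation

open MeasureTheory

variable {E : Type*} [NormedAddCommGroup E] [InnerProductSpace ℝ E]

/-- The support function of the zonotope with the generators in a list. -/
noncomputable def zonotopeSupport (l : List E) (x : E) : ℝ :=
  (l.map fun z => |inner ℝ x z|).sum

theorem inner_le_zonotopeSupport (l : List E) (x : E) :
    ∀ y ∈ zonotope l, inner ℝ x y ≤ zonotopeSupport l x := by
  induction l with
  | nil =>
    intro y hy
    rw [zonotope, Set.mem_zero] at hy
    simp [hy, zonotopeSupport]
  | cons z l ih =>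
    rintro _ ⟨_, ⟨s, hs, rfl⟩, y, hy, rfl⟩
    rw [zonotopeSupport, List.map_cons, List.sum_cons]
    refine (inner_add_right x _ y).le.trans (add_le_add ?_ (ih y hy))
    rw [inner_smul_right]
    refine (le_abs_self _).trans ?_
    rw [abs_mul]
    exact mul_le_of_le_one_left (abs_nonneg _) (abs_le.2 hs)

theorem exists_inner_eq_zonotopeSupport (l : List E) (x : E) :
    ∃ y ∈ zonotope l, inner ℝ x y = zonotopeSupport l x := by
  induction l with
  | nil => exact ⟨0, rfl, by simp [zonotopeSupport]⟩
  | cons z l ih =>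
    obtain ⟨y, hy, h⟩ := ih
    obtain ⟨s, hs, h'⟩ : ∃ s ∈ Set.Icc (-1 : ℝ) 1, s * inner ℝ x z = |inner ℝ x z| := by
      rcases abs_choice (inner ℝ x z) with h | h
      · exact ⟨1, by norm_num, by rw [h, one_mul]⟩
      · exact ⟨-1, by norm_num, by rw [h, neg_one_mul]⟩
    refine ⟨s • z + y, Set.add_mem_add ⟨s, hs, rfl⟩ hy, ?_⟩
    rw [inner_add_right, inner_smul_right, h', h]
    simp only [zonotopeSupport, List.map_cons, List.sum_cons]

/-- A point outside the compact convex zonotope would be strictly separated from it by some w, but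
the support function of the zonotope at w is at least ‖w‖. -/
theorem closedBall_subset_zonotope [CompleteSpace E] {l : List E}
    (h : ∀ x, ‖x‖ ≤ zonotopeSupport l x) : Metric.closedBall 0 1 ⊆ zonotope l := by
  intro x hx
  by_contra hxl
  obtain ⟨f, u, hf, hu⟩ := geometric_hahn_banach_closed_point (convex_zonotope l)
    (isCompact_zonotope l).isClosed hxl
  obtain ⟨w, rfl⟩ := (InnerProductSpace.toDual ℝ E).surjective f
  simp only [InnerProductSpace.toDual_apply_apply] at hf hu
  obtain ⟨y, hy, hyw⟩ := exists_inner_eq_zonotopeSupport l w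
  have h1 := hf y hy
  have h2 := h w
  have h3 := real_inner_le_norm w x
  have h4 : ‖x‖ ≤ 1 := by simpa using hx
  nlinarith [norm_nonneg w]

/-- For y in the zonotope, ‖y‖² = ⟨y, y⟩ is at most the support function at y. -/
theorem zonotope_subset_closedBall {l : List E} {c : ℝ} (hc : 0 ≤ c)
    (h : ∀ x, zonotopeSupport l x ≤ c * ‖x‖) : zonotope l ⊆ Metric.closedBall 0 c := by
  intro y hy
  have h1 := (inner_le_zonotopeSupport l y y hy).trans (h y)
  rw [real_inner_self_eq_norm_sq] at h1
  rw [mem_closedBall_zero_iff]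
  by_contra! h2
  nlinarith [norm_nonneg y]

variable [FiniteDimensional ℝ E] [MeasurableSpace E] [BorelSpace E]

/-- By rotation invariance the norm is a multiple of an average of the functions |⟨x, u⟩|, which are
support functions of segments: a reflection carries the direction of x to a fixed unit vector e. The
constant is positive because the integrand vanishes only on a hyperplane. -/
theorem exists_integral_abs_inner_eq [Nontrivial E] : ∃ C : ℝ, 0 < C ∧ ∀ x : E,
    ∫ u in Metric.closedBall (0 : E) 1, |inner ℝ x u| = C * ‖x‖ := by
  obtain ⟨e, he⟩ := exists_norm_eq E (zero_le_one' ℝ)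
  have he0 : e ≠ 0 := by
    rintro rfl
    simp at he
  refine ⟨∫ u in Metric.closedBall (0 : E) 1, |inner ℝ e u|, ?_, fun x => ?_⟩
  · rw [setIntegral_pos_iff_support_of_nonneg_ae
      (Filter.Eventually.of_forall fun u => abs_nonneg _)
      ((by fun_prop : Continuous fun u : E => |inner ℝ e u|).continuousOn.integrableOn_compact
        (isCompact_closedBall 0 1))]
    have h0 : volume ((ℝ ∙ e)ᗮ : Set E) = 0 := by
      refine Measure.addHaar_submodule volume _ fun h => he0 ?_
      have h1 : e ∈ (ℝ ∙ e)ᗮ := h ▸ Submodule.mem_top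
      exact inner_self_eq_zero.1 (Submodule.mem_orthogonal_singleton_iff_inner_right.1 h1)
    have h1 : Function.support (fun u : E => |inner ℝ e u|) = ((ℝ ∙ e)ᗮ : Set E)ᶜ := by
      ext u
      simp [Submodule.mem_orthogonal_singleton_iff_inner_right]
    rw [h1, Set.inter_comm, ← Set.sdiff_eq, measure_sdiff_null h0]
    exact Metric.measure_closedBall_pos _ _ one_pos
  · have hx : ∃ y : E, ‖y‖ = 1 ∧ x = ‖x‖ • y := by
      by_cases h : x = 0
      · exact ⟨e, he, by simp [h]⟩
      · have h' : ‖x‖ ≠ 0 := norm_ne_zero_iff.2 h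
        exact ⟨‖x‖⁻¹ • x, by simp [norm_smul, h'], by rw [smul_inv_smul₀ h']⟩
    obtain ⟨y, hy, hxy⟩ := hx
    let A : E ≃ₗᵢ[ℝ] E := (ℝ ∙ (y - e))ᗮ.reflection
    have hA : A y = e := Submodule.reflection_sub (hy.trans he.symm)
    have hpre : A ⁻¹' Metric.closedBall (0 : E) 1 = Metric.closedBall 0 1 := by
      rw [A.preimage_closedBall, map_zero]
    have h := A.measurePreserving.setIntegral_preimage_emb
      A.toHomeomorph.measurableEmbedding (fun u => |inner ℝ e u|) (Metric.closedBall 0 1)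
    rw [hpre] at h
    rw [← h, ← integral_mul_const]
    refine integral_congr_ae (Filter.Eventually.of_forall fun u => ?_)
    change |inner ℝ x u| = |inner ℝ e (A u)| * ‖x‖
    rw [← hA, A.inner_map_map]
    conv_lhs => rw [hxy, real_inner_smul_left, abs_mul, abs_norm, mul_comm]

/-- The ball is a limit of zonotopes. -/
theorem exists_zonotope_between (E : Type*) [NormedAddCommGroup E] [InnerProductSpace ℝ E]
    [FiniteDimensional ℝ E] {ε : ℝ} (hε : 0 < ε) : ∃ l : List E,
    Metric.closedBall 0 1 ⊆ zonotope l ∧ zonotope l ⊆ Metric.closedBall 0 (1 + ε) := by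
  rcases subsingleton_or_nontrivial E with hE | hE
  · refine ⟨[], fun x _ => Subsingleton.elim _ _, fun x _ => ?_⟩
    rw [Subsingleton.elim x 0]
    exact Metric.mem_closedBall_self (by linarith)
  borelize E
  obtain ⟨C, hC, hint⟩ := exists_integral_abs_inner_eq (E := E)
  set μ : Measure E := volume.restrict (Metric.closedBall 0 1) with hμ
  have hfin : IsFiniteMeasure μ := ⟨by
    rw [hμ, Measure.restrict_apply_univ]
    exact (isCompact_closedBall (0 : E) 1).measure_lt_top⟩
  have hid : Integrable (fun u : E => u) μ :=
    continuous_id.continuousOn.integrableOn_compact (isCompact_closedBall 0 1)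
  -- Chosen so that (C + δ) / (C - δ) = 1 + ε.
  set δ : ℝ := C * ε / (2 + ε) with hδ
  have hδ0 : 0 < δ := by positivity
  have hlim := SimpleFunc.tendsto_approxOn_range_L1_enorm (fmeas := measurable_id) hid
  obtain ⟨n, hn⟩ := (hlim.eventually (gt_mem_nhds (ENNReal.ofReal_pos.2 hδ0))).exists
  -- Replacing u by an L¹-close simple function makes the integral of |⟨x, u⟩| a finite sum, the
  -- support function of a zonotope, with error at most δ ‖x‖.
  set s := SimpleFunc.approxOn (fun u : E => u) measurable_id (Set.range (fun u : E => u) ∪ {0}) 0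
    (by simp) n with hs
  have hsint : Integrable s μ := s.integrable_of_isFiniteMeasure
  have hdist : ∫ u, ‖s u - u‖ ∂μ ≤ δ := by
    refine (integral_norm_eq_lintegral_enorm (hsint.sub hid).aestronglyMeasurable).trans_le ?_
    exact ENNReal.toReal_le_of_le_ofReal hδ0.le hn.le
  have hinner : ∀ x : E, Integrable (fun u => |inner ℝ x u|) μ := fun x =>
    (hid.const_inner x).abs
  have hinners : ∀ x : E, Integrable (fun u => |inner ℝ x (s u)|) μ := fun x =>
    (hsint.const_inner x).abs
  have happ : ∀ x : E, |∫ u, |inner ℝ x (s u)| ∂μ - C * ‖x‖| ≤ δ * ‖x‖ := by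
    intro x
    rw [← hint x, ← integral_sub (hinners x) (hinner x)]
    refine (abs_integral_le_integral_abs).trans ?_
    refine (integral_mono ((hinners x).sub (hinner x)).abs
      ((hsint.sub hid).norm.mul_const ‖x‖) fun u => ?_).trans ?_
    · refine (abs_abs_sub_abs_le_abs_sub _ _).trans ?_
      rw [← inner_sub_right, mul_comm]
      exact abs_real_inner_le_norm _ _
    · rw [integral_mul_const]
      exact mul_le_mul_of_nonneg_right hdist (norm_nonneg x)
  have hsum : ∀ x : E, ∫ u, |inner ℝ x (s u)| ∂μ =
      ∑ v ∈ s.range, μ.real (s ⁻¹' {v}) * |inner ℝ x v| := by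
    intro x
    have h := SimpleFunc.map_integral s (fun v => |inner ℝ x v|) hsint (by simp)
    rw [SimpleFunc.integral_eq_integral _ (hinners x)] at h
    exact h
  have hCδ : C - δ = 2 * C / (2 + ε) := by
    rw [hδ]
    field_simp
    ring
  have ha : 0 < C - δ := by
    rw [hCδ]
    positivity
  -- Each value of s, weighted by the measure of its fibre. Division by C - δ raises the lower bound
  -- for the support function to ‖x‖; the upper bound becomes (1 + ε) ‖x‖.
  let l : List E := s.range.toList.map fun v => ((C - δ)⁻¹ * μ.real (s ⁻¹' {v})) • v
  have hsupp : ∀ x : E, zonotopeSupport l x = (C - δ)⁻¹ * ∫ u, |inner ℝ x (s u)| ∂μ := by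
    intro x
    rw [hsum, zonotopeSupport, List.map_map, Finset.mul_sum, Finset.sum_map_toList]
    refine Finset.sum_congr rfl fun v _ => ?_
    simp only [Function.comp_apply, inner_smul_right, abs_mul, abs_inv, abs_of_pos ha,
      abs_of_nonneg measureReal_nonneg, mul_assoc]
  refine ⟨l, closedBall_subset_zonotope fun x => ?_,
    zonotope_subset_closedBall (by linarith) fun x => ?_⟩
  · rw [hsupp, ← div_eq_inv_mul, le_div_iff₀ ha]
    linarith [(abs_le.1 (happ x)).1]
  · rw [hsupp, ← div_eq_inv_mul, div_le_iff₀ ha]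
    have h1 : (1 + ε) * (C - δ) = C + δ := by
      rw [hδ]
      field_simp
      ring
    have h2 : (1 + ε) * ‖x‖ * (C - δ) = (C + δ) * ‖x‖ := by rw [← h1]; ring
    rw [h2]
    linarith [(abs_le.1 (happ x)).2]

end BallApproximation

/-! ### Steiner's formula and the alternating sums of its coefficients -/

section Steiner

open MeasureTheory Filter Topology

/-- The larger parallel body is the closed r ε-thickening of the compact set K + B(0, r), and the
volumes of such thickenings converge. -/
theorem tendsto_measureReal_add_closedBall {d : ℕ} {K : Set (EuclideanSpace ℝ (Fin d))}
    (hK : IsCompact K) {r : ℝ} (hr : 0 ≤ r) {ε : ℕ → ℝ} (hε : ∀ n, 0 < ε n)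
    (hlim : Tendsto ε atTop (𝓝 0)) :
    Tendsto (fun n => volume.real (K + Metric.closedBall 0 (r * (1 + ε n)))) atTop
      (𝓝 (volume.real (K + Metric.closedBall 0 r))) := by
  have hS : IsCompact (K + Metric.closedBall (0 : EuclideanSpace ℝ (Fin d)) r) :=
    hK.add (isCompact_closedBall 0 r)
  have h1 : ∀ n, K + Metric.closedBall (0 : EuclideanSpace ℝ (Fin d)) (r * (1 + ε n)) =
      Metric.cthickening (r * ε n) (K + Metric.closedBall 0 r) := fun n => by
    rw [← hS.add_closedBall_zero (mul_nonneg hr (hε n).le), add_assoc,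
      closedBall_add_closedBall hr (mul_nonneg hr (hε n).le), add_zero, mul_add, mul_one]
  simp_rw [h1]
  have h2 : Tendsto (fun n => r * ε n) atTop (𝓝 0) := by simpa using hlim.const_mul r
  exact (ENNReal.tendsto_toReal hS.measure_lt_top.ne).comp
    ((tendsto_measure_cthickening_of_isCompact (μ := volume) hS).comp h2)

theorem tendsto_measureReal_add_zonotope {d : ℕ} {K : Set (EuclideanSpace ℝ (Fin d))}
    (hK : IsCompact K) {r : ℝ} (hr : 0 ≤ r) {ε : ℕ → ℝ} (hε : ∀ n, 0 < ε n)
    (hlim : Tendsto ε atTop (𝓝 0)) {l : ℕ → List (EuclideanSpace ℝ (Fin d))}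
    (h1 : ∀ n, Metric.closedBall 0 1 ⊆ zonotope (l n))
    (h2 : ∀ n, zonotope (l n) ⊆ Metric.closedBall 0 (1 + ε n)) :
    Tendsto (fun n => volume.real (K + r • zonotope (l n))) atTop
      (𝓝 (volume.real (K + Metric.closedBall 0 r))) := by
  refine tendsto_of_tendsto_of_tendsto_of_le_of_le tendsto_const_nhds
    (tendsto_measureReal_add_closedBall hK hr hε hlim) (fun n => ?_) fun n => ?_
  · refine measureReal_mono (Set.add_subset_add_left ?_)
      (hK.add ((isCompact_zonotope _).smul r)).measure_lt_top.ne
    have h := Set.smul_set_mono (a := r) (h1 n)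
    rwa [smul_closedBall _ _ zero_le_one, smul_zero, Real.norm_of_nonneg hr, mul_one] at h
  · refine measureReal_mono (Set.add_subset_add_left ?_)
      (hK.add (isCompact_closedBall _ _)).measure_lt_top.ne
    have h := Set.smul_set_mono (a := r) (h2 n)
    have hn := hε n
    rwa [smul_closedBall _ _ (by linarith), smul_zero, Real.norm_of_nonneg hr] at h

theorem coeff_interpolate (s : Finset ℕ) (v y : ℕ → ℝ) (k : ℕ) :
    (Lagrange.interpolate s v y).coeff k = ∑ i ∈ s, y i * (Lagrange.basis s v i).coeff k := by
  simp [Lagrange.interpolate_apply]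

theorem eval_interpolate (s : Finset ℕ) (v y : ℕ → ℝ) (r : ℝ) :
    (Lagrange.interpolate s v y).eval r = ∑ i ∈ s, y i * (Lagrange.basis s v i).eval r := by
  simp [Lagrange.interpolate_apply, Polynomial.eval_finsetSum]

theorem eq_interpolate_range {P : Polynomial ℝ} {d : ℕ} (hP : P.natDegree ≤ d) :
    P = Lagrange.interpolate (Finset.range (d + 1)) (fun i : ℕ => (i : ℝ))
      (fun i => P.eval (i : ℝ)) := by
  refine Lagrange.eq_interpolate_of_eval_eq _ (Nat.cast_injective.injOn) ?_ fun i _ => rfl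
  rw [Finset.card_range]
  exact (Polynomial.degree_le_of_natDegree_le hP).trans_lt
    (by exact_mod_cast Nat.lt_succ_self d)

/-- Steiner's formula, with the alternating sums of the coefficients over the convex hulls of
the subfamilies of a finite family of points. -/
theorem exists_steinerPolynomial (N d : ℕ) :
    ∃ Q : Set (EuclideanSpace ℝ (Fin d)) → Polynomial ℝ,
      (∀ K, IsCompact K → Convex ℝ K → IsSteinerPolynomial K (Q K)) ∧
      ∀ (p : Fin N → EuclideanSpace ℝ (Fin d)) (I : Finset (Fin N)) (k : ℕ),
        ∑ J ∈ I.powerset, (-1 : ℝ) ^ (J.card + 1) * (Q (hullOf p J)).coeff k =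
          (-1) ^ (d + k) * (Q (hullOf p I)).coeff k := by
  have hε : ∀ n : ℕ, (0 : ℝ) < 1 / ((n : ℝ) + 1) := fun n => by positivity
  have hlim := tendsto_one_div_add_atTop_nhds_zero_nat (𝕜 := ℝ)
  choose l hl1 hl2 using fun n => exists_zonotope_between (EuclideanSpace ℝ (Fin d)) (hε n)
  choose P hP hPv hPs using fun n => exists_polynomial_add_zonotope (N := N) (l n)
  -- The candidate interpolates the parallel volumes at the radii 0, …, d. The zonotope polynomials
  -- have degree at most d, so they too are recovered from these values, and their values and
  -- coefficients converge to those of Q.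
  let Q : Set (EuclideanSpace ℝ (Fin d)) → Polynomial ℝ := fun K =>
    Lagrange.interpolate (Finset.range (d + 1)) (fun i : ℕ => (i : ℝ))
      (fun i => volume.real (K + Metric.closedBall 0 (i : ℝ)))
  have heval : ∀ K, IsCompact K → Convex ℝ K → ∀ r : ℝ, 0 ≤ r →
      Tendsto (fun n => (P n K).eval r) atTop
        (𝓝 (volume.real (K + Metric.closedBall 0 r))) := by
    intro K hK hc r hr
    simp_rw [← hPv _ K hK hc r hr]
    exact tendsto_measureReal_add_zonotope hK hr hε hlim hl1 hl2
  have hcoeff : ∀ K, IsCompact K → Convex ℝ K → ∀ k : ℕ,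
      Tendsto (fun n => (P n K).coeff k) atTop (𝓝 ((Q K).coeff k)) := by
    intro K hK hc k
    rw [coeff_interpolate]
    have h : ∀ n, (P n K).coeff k = ∑ i ∈ Finset.range (d + 1), (P n K).eval (i : ℝ) *
        (Lagrange.basis (Finset.range (d + 1)) (fun i : ℕ => (i : ℝ)) i).coeff k := fun n => by
      conv_lhs => rw [eq_interpolate_range (hP n K)]
      rw [coeff_interpolate]
    simp_rw [h]
    exact tendsto_finsetSum _ fun i _ => (heval K hK hc i i.cast_nonneg).mul_const _
  refine ⟨Q, fun K hK hc r hr => ?_, fun p I k => ?_⟩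
  · refine tendsto_nhds_unique (heval K hK hc r hr) ?_
    rw [eval_interpolate]
    have h : ∀ n, (P n K).eval r = ∑ i ∈ Finset.range (d + 1), (P n K).eval (i : ℝ) *
        (Lagrange.basis (Finset.range (d + 1)) (fun i : ℕ => (i : ℝ)) i).eval r := fun n => by
      conv_lhs => rw [eq_interpolate_range (hP n K)]
      rw [eval_interpolate]
    simp_rw [h]
    exact tendsto_finsetSum _ fun i _ => (heval K hK hc i i.cast_nonneg).mul_const _
  · have hhull : ∀ J, Tendsto (fun n => (P n (hullOf p J)).coeff k) atTop
        (𝓝 ((Q (hullOf p J)).coeff k)) := fun J =>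
      hcoeff _ (isCompact_convexHull_image p J) (convex_convexHull ℝ _) k
    refine tendsto_nhds_unique (tendsto_finsetSum _ fun J _ => (hhull J).const_mul _) ?_
    simp_rw [hPs]
    exact (hhull I).const_mul _

theorem sum_coeff_steinerPolynomial {N d : ℕ} (p : Fin N → EuclideanSpace ℝ (Fin d))
    (I : Finset (Fin N)) (k : ℕ) :
    ∑ J ∈ I.powerset, (-1 : ℝ) ^ (J.card + 1) * (steinerPolynomial (hullOf p J)).coeff k =
      (-1) ^ (d + k) * (steinerPolynomial (hullOf p I)).coeff k := by
  obtain ⟨Q, hQ, hs⟩ := exists_steinerPolynomial N d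
  have h : ∀ J, steinerPolynomial (hullOf p J) = Q (hullOf p J) := fun J =>
    (hQ _ (isCompact_convexHull_image p J) (convex_convexHull ℝ _)).eq
  simp only [h, hs]

theorem sum_quermassintegral {N d : ℕ} (p : Fin N → EuclideanSpace ℝ (Fin d))
    (I : Finset (Fin N)) {k : ℕ} (hk : k ≤ d) :
    ∑ J ∈ I.powerset, (-1 : ℝ) ^ (J.card + 1) * quermassintegral k (hullOf p J) =
      (-1) ^ (d - k) * quermassintegral k (hullOf p I) := by
  have hsign : (-1 : ℝ) ^ (d + k) = (-1) ^ (d - k) := by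
    rw [show d + k = d - k + 2 * k by omega, pow_add, pow_mul]
    simp
  simp only [quermassintegral, ← mul_div_assoc, ← Finset.sum_div]
  rw [sum_coeff_steinerPolynomial, hsign]

theorem sum_intrinsicVolume {N d : ℕ} (p : Fin N → EuclideanSpace ℝ (Fin d))
    (I : Finset (Fin N)) (k : ℕ) :
    ∑ J ∈ I.powerset, (-1 : ℝ) ^ (J.card + 1) * intrinsicVolume k (hullOf p J) =
      (-1) ^ k * intrinsicVolume k (hullOf p I) := by
  by_cases hk : k ≤ d
  · have hsign : (-1 : ℝ) ^ (d + (d - k)) = (-1) ^ k := by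
      rw [show d + (d - k) = k + 2 * (d - k) by omega, pow_add, pow_mul]
      simp
    simp only [intrinsicVolume, if_pos hk, ← mul_div_assoc, ← Finset.sum_div]
    rw [sum_coeff_steinerPolynomial, hsign]
  · simp [intrinsicVolume, hk]

end Steiner

/-! ### Duality for `0`-weight extensions -/

section Duality

open FreeBool BddExpr

variable {N : ℕ}

theorem FreeBool.contradual_sup (f g : FreeBool N) :
    (f ⊔ g).contradual = f.contradual ⊔ g.contradual := eval_sup _ f g

theorem FreeBool.contradual_inf (f g : FreeBool N) :
    (f ⊓ g).contradual = f.contradual ⊓ g.contradual := eval_inf _ f g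

theorem FreeBool.dual_sup (f g : FreeBool N) : (f ⊔ g).dual = f.dual ⊓ g.dual := by
  rw [dual, contradual_sup, compl_sup, dual, dual]

theorem FreeBool.dual_inf (f g : FreeBool N) : (f ⊓ g).dual = f.dual ⊔ g.dual := by
  rw [dual, contradual_inf, compl_inf, dual, dual]

theorem FreeBool.dual_top : (⊤ : FreeBool N).dual = ⊥ := by
  rw [dual, contradual, eval_top, compl_top]

theorem FreeBool.dual_bot : (⊥ : FreeBool N).dual = ⊤ := by
  rw [dual, contradual, eval_bot, compl_bot]

/-- The dual negates both the inputs and the output, and complementing the set of false variables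
negates the inputs. -/
theorem FreeBool.truth_dual (K : Finset (Fin N)) (f : FreeBool N) :
    truth K f.dual ↔ ¬ truth Kᶜ f := by
  rw [dual, truth_compl, not_iff_not]
  induction f using FreeBool.induction with
  | hvar i => simp [contradual]
  | htop => simp [contradual]
  | hbot => simp [contradual]
  | hsup f g hf hg => simp [contradual_sup, hf, hg]
  | hinf f g hf hg => simp [contradual_inf, hf, hg]
  | hcompl f hf =>
    have h : fᶜ.contradual = f.contradualᶜ := eval_compl _ f
    simp [h, hf]

namespace BddExpr

theorem unionCoeff_unionVar [NeZero N] (I : {I : Finset (Fin N) // I.Nonempty}) :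
    unionCoeff (unionVar I) = fun J => if J = I then 1 else 0 := by
  refine (existsUnique_unionCoeff (unionVar I)).unique
    (fun μ hμ => unionCoeff_spec _ hμ) fun μ _ => ?_
  simp

theorem combination_unionVar [NeZero N] (v : {I : Finset (Fin N) // I.Nonempty} → ℝ)
    (I : {I : Finset (Fin N) // I.Nonempty}) : (combination v).1 (unionVar I) = v I := by
  simp [combination, unionCoeff_unionVar]

/-- A modular function on `𝓑_N` that vanishes at `∅` and `X` is determined by its values at the
unions of variables. -/
theorem eq_of_eq_on_unionVar [NeZero N] {ν ρ : FreeBool N → ℝ}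
    (hν : ∀ f g, ν (f ⊔ g) = ν f + ν g - ν (f ⊓ g)) (hν0 : ν ⊥ = 0) (hν1 : ν ⊤ = 0)
    (hρ : ∀ f g, ρ (f ⊔ g) = ρ f + ρ g - ρ (f ⊓ g)) (hρ0 : ρ ⊥ = 0) (hρ1 : ρ ⊤ = 0)
    (h : ∀ I : {I : Finset (Fin N) // I.Nonempty},
      ν (unionVar I : FreeBool N) = ρ (unionVar I : FreeBool N)) : ν = ρ := by
  have hadd : ∀ ν : FreeBool N → ℝ, (∀ f g, ν (f ⊔ g) = ν f + ν g - ν (f ⊓ g)) → ν ⊥ = 0 →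
      (fun f : BddExpr N => ν f) ∈ additive N := by
    intro ν hν hν0 f g hfg
    have := hν f g
    rw [hfg, hν0, sub_zero] at this
    exact this
  have hbdd : ∀ f, IsBounded f → ν f = ρ f := by
    intro f hf
    have h1 := unionCoeff_spec ⟨f, hf⟩ (hadd ν hν hν0)
    have h2 := unionCoeff_spec ⟨f, hf⟩ (hadd ρ hρ hρ0)
    simp only [h] at h1
    exact h1.trans h2.symm
  funext f
  -- Elements outside 𝓒_N have their complement in 𝓒_N, and modularity expresses their value through
  -- it.
  rcases isBounded_or_compl f with hf | hf
  · exact hbdd f hf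
  · have h1 := hν f fᶜ
    have h2 := hρ f fᶜ
    rw [sup_compl_eq_top, inf_compl_eq_bot] at h1 h2
    have h3 := hbdd _ hf
    linarith

open Classical in
/-- Inclusion-exclusion for the dual of a union of variables. -/
theorem dual_unionVar_eq_sum {ν : FreeBool N → ℝ} (hν0 : ν ⊥ = 0)
    (hν : ∀ f g, ν (f ⊔ g) = ν f + ν g - ν (f ⊓ g))
    (I : {I : Finset (Fin N) // I.Nonempty}) (v : Finset (Fin N) → ℝ)
    (hv : ∀ J : {I : Finset (Fin N) // I.Nonempty}, ν (unionVar J : FreeBool N) = v J.1)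
    (hv0 : v ∅ = 0) :
    ν (unionVar I : FreeBool N).dual =
      ∑ J ∈ I.1.powerset, (-1 : ℝ) ^ (J.card + 1) * v J := by
  -- The atom a_K lies below u_J exactly when J is not contained in K. Exchanging the sums leaves,
  -- for each K, an alternating sum over J ⊆ I.
  have hv' : ∀ J : Finset (Fin N), v J = ∑ K, if J ⊆ K then 0 else ν (atom K) := by
    intro J
    rcases J.eq_empty_or_nonempty with rfl | hJ
    · simp [hv0]
    · rw [← hv ⟨J, hJ⟩, modular_eq_sum hν0 hν]
      refine Finset.sum_congr rfl fun K _ => ?_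
      simp [truth_unionVar]
  rw [modular_eq_sum hν0 hν]
  simp_rw [hv', Finset.mul_sum]
  rw [Finset.sum_comm]
  refine Finset.sum_congr rfl fun K _ => ?_
  have hterm : ∀ J : Finset (Fin N), (-1 : ℝ) ^ (J.card + 1) *
      (if J ⊆ K then 0 else ν (atom K)) =
      ν (atom K) * (if J ⊆ K then (-1) ^ J.card else 0) - ν (atom K) * (-1) ^ J.card := by
    intro J
    split_ifs <;> ring
  have hfilter : I.1.powerset.filter (· ⊆ K) = (I.1 ∩ K).powerset := by
    ext J
    rw [Finset.mem_filter, Finset.mem_powerset, Finset.mem_powerset, Finset.subset_inter_iff]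
  have hcard : ∀ s : Finset (Fin N), ∑ J ∈ s.powerset, (-1 : ℝ) ^ J.card =
      if s = ∅ then 1 else 0 := fun s => by
    have h := congrArg (Int.cast : ℤ → ℝ) (Finset.sum_powerset_neg_one_pow_card (x := s))
    push_cast at h
    exact h
  simp_rw [hterm]
  -- The sum over J ⊆ I ∩ K is the indicator of I ∩ K = ∅, which is the condition for a_K to lie
  -- below the intersection of the x_i; the sum over all J ⊆ I vanishes as I ≠ ∅.
  rw [Finset.sum_sub_distrib, ← Finset.mul_sum, ← Finset.mul_sum, ← Finset.sum_filter, hfilter,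
    hcard, hcard, if_neg I.2.ne_empty, mul_zero, sub_zero]
  have hiff : truth K (unionVar I : FreeBool N).dual ↔ I.1 ∩ K = ∅ := by
    rw [truth_dual, truth_unionVar, not_not, ← Finset.disjoint_iff_inter_eq_empty,
      Finset.disjoint_left]
    simp [Finset.subset_iff]
  simp [hiff]

theorem zeroWeightExtension_bot [NeZero N] (μ : additive N) : zeroWeightExtension μ ⊥ = 0 := by
  have h := (isZeroWeightExtension μ).extends_eq ⟨⊥, isBounded_bot⟩
  rw [additive_bot μ.2 _ rfl] at h
  exact h

/-- The behaviour of a `0`-weight extension under duality is determined by the alternating sums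
of the values at unions of variables. -/
theorem zeroWeightExtension_dual [NeZero N] (w : Finset (Fin N) → ℝ) (hw0 : w ∅ = 0) (s : ℝ)
    (hw : ∀ I : Finset (Fin N),
      ∑ J ∈ I.powerset, (-1 : ℝ) ^ (J.card + 1) * w J = s * w I) (f : FreeBool N) :
    zeroWeightExtension (combination fun I => w I.1) f.dual =
      s * zeroWeightExtension (combination fun I => w I.1) f := by
  have hext := isZeroWeightExtension (combination fun I => w I.1)
  set ν := zeroWeightExtension (combination fun I => w I.1)
  have hbot : ν ⊥ = 0 := zeroWeightExtension_bot _
  have hval : ∀ I : {I : Finset (Fin N) // I.Nonempty},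
      ν (unionVar I : FreeBool N) = w I.1 := fun I => by
    rw [hext.extends_eq, combination_unionVar]
  refine congrFun (eq_of_eq_on_unionVar (ν := fun f => ν f.dual) (ρ := fun f => s * ν f)
    (fun f g => ?_) ?_ ?_ (fun f g => ?_) ?_ ?_ fun I => ?_) f
  · have h := hext.modular f.dual g.dual
    rw [dual_sup, dual_inf]
    linarith
  · rw [dual_bot, hext.top_eq]
  · rw [dual_top, hbot]
  · rw [hext.modular]
    ring
  · rw [hbot, mul_zero]
  · rw [hext.top_eq, mul_zero]
  · rw [dual_unionVar_eq_sum hbot hext.modular I w hval hw0, hw, hval]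

theorem zeroWeightExtension_compl [NeZero N] (μ : additive N) (f : FreeBool N) :
    zeroWeightExtension μ fᶜ = -zeroWeightExtension μ f := by
  have hext := isZeroWeightExtension μ
  have h := hext.modular f fᶜ
  rw [sup_compl_eq_top, inf_compl_eq_bot, hext.top_eq, zeroWeightExtension_bot] at h
  linarith

end BddExpr

end Duality

/-- The alternating sums include J = ∅, whose hull is empty; this makes its term zero. -/
theorem steinerPolynomial_empty {d : ℕ} :
    steinerPolynomial (∅ : Set (EuclideanSpace ℝ (Fin d))) = 0 :=
  IsSteinerPolynomial.eq fun r _ => by simp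

theorem proposition5p3 (N : ℕ) [NeZero N] (d : ℕ) (f : FreeBool N)
    (p : Fin N → EuclideanSpace ℝ (Fin d)) :
    (∀ k : ℕ,
      boolIntrinsicVolume f.dual k p = -boolIntrinsicVolume f.contradual k p ∧
      -boolIntrinsicVolume f.contradual k p = (-1 : ℝ) ^ k * boolIntrinsicVolume f k p) ∧
    (∀ k : ℕ, k ≤ d →
      boolQuermassintegral f.dual k p = -boolQuermassintegral f.contradual k p ∧
      -boolQuermassintegral f.contradual k p =
        (-1 : ℝ) ^ (d - k) * boolQuermassintegral f k p) := by
  refine ⟨fun k => ?_, fun k hk => ?_⟩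
  · have h1 : boolIntrinsicVolume f.dual k p = -boolIntrinsicVolume f.contradual k p :=
      BddExpr.zeroWeightExtension_compl _ _
    refine ⟨h1, h1.symm.trans ?_⟩
    exact BddExpr.zeroWeightExtension_dual (fun I => intrinsicVolume k (hullOf p I))
      (by simp [intrinsicVolume, hullOf, steinerPolynomial_empty]) _
      (fun I => sum_intrinsicVolume p I k) f
  · have h1 : boolQuermassintegral f.dual k p = -boolQuermassintegral f.contradual k p :=
      BddExpr.zeroWeightExtension_compl _ _
    refine ⟨h1, h1.symm.trans ?_⟩
    exact BddExpr.zeroWeightExtension_dual (fun I => quermassintegral k (hullOf p I))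
      (by simp [quermassintegral, hullOf, steinerPolynomial_empty]) _
      (fun I => sum_quermassintegral p I hk) f
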